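/- Let $\mathbf C$ be a category and $W$ a class of arrows of $\mathbf C$ such that: (CF1) $W$ contains all isomorphisms and is closed under composition; (CF2) for $f\colon C\to B$ and $w\colon A\to B$ in $W$ there are $\bar w\colon D\to C$ in $W$ and $\bar f\colon D\to A$ with $w\bar f=f\bar w$; (CF3) if $wf=wg$ with $w\in W$, there is $\tilde w\in W$ with $f\tilde w=g\tilde w$. **Definitions.** *The bicategory of fractions $\mathbf C(W^{-1})$*, formed with any choice of squares as in (CF2): objects are those of $\mathbf C$; arrows $A\to B$ are spans $A\xleftarrow{w}S\xrightarrow{f}B$ with $w\in W$, composed by means of the chosen squares; 2-cells $(w_1,S_1,f_1)\Rightarrow(w_2,S_2,f_2)$ are classes of diagrams $S_1\xleftarrow{u_1}T\xrightarrow{u_2}S_2$ with $w_1u_1=w_2u_2\in W$ and $f_1u_1=f_2u_2$, two diagrams being identified when they have a common refinement $t,t'$ with $w_1u_1t\in W$. *The double category $\mathbf C\{W\}$*: objects are the arrows $(w\colon A\to B)$ in $W$. A horizontal arrow $(A\xrightarrow{w}B)\to(A'\xrightarrow{w'}B')$ is an arrow $f\colon A\to A'$ of $\mathbf C$, composed as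 in $\mathbf C$. A vertical arrow $(A_1\xrightarrow{w_1}B)\to(A_2\xrightarrow{w_2}B)$ is a class of diagrams $A_1\xleftarrow{u_1}C\xrightarrow{u_2}A_2$ with $w_1u_1=w_2u_2\in W$; two diagrams are identified when they have a common refinement $r_1,r_2$ with $w_1u_1r_1\in W$. A double cell with top $f_1$ (from $w_1$ to $w_1'$), bottom $f_2$ (from $w_2$ to $w_2'$), left side $x$ and right side $y$ is a class of families which assign, to each pair of representatives $(u_1,C,u_2)$ of $x$ and $(u_1',C',u_2')$ of $y$, a (possibly empty) set of arrows $\varphi\colon C\to C'$ with $f_1u_1=u_1'\varphi$ and $f_2u_2=u_2'\varphi$, such that the set is non-empty after replacing $(u_1,u_2)$ by $(u_1r,u_2r)$ for some $r$ with $w_1u_1r\in W$, and such that the family is closed under composition with every such $r$; two families are identified when for each pair of representatives they share an arrow after such a replacement. There is at most one vertical arrow between two objects, and at most one double cell in each frame; this determines the remaining compositions. A double category $\mathbb X$, with category $\mathbb X_0$ of objects and vertical arrows and category $\mathbb X_1$ of horizontal arrows and double cells, is *weakly globular* if $\mathbb X_0$ is equivalent to the discrete category $\mathbb X_0^d$ of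 its path components and for all $n\ge 2$ the induced Segal map $\mathbb X_1\times_{\mathbb X_0}\cdots\times_{\mathbb X_0}\mathbb X_1\to\mathbb X_1\times_{\mathbb X_0^d}\cdots\times_{\mathbb X_0^d}\mathbb X_1$ ($n$ factors) is an equivalence of categories. Its *fundamental bicategory* $\mathbf{Bic}(\mathbb X)$ has the path components of $\mathbb X_0$ as objects, the horizontal arrows between objects of two components as arrows between these components, and double cells as 2-cells; two arrows are composed by first replacing them by a chosen isomorphic (in $\mathbb X_1$) horizontally composable pair; the units are the horizontal identities of chosen representatives of the components. In $\mathbf{Bic}(\mathbf C\{W\})$ the component of $w\colon A\to B$ is represented by $1_B$; the choice of composable replacements is arbitrary. *$\mathbf{Bicat}_{\rm icon}$* is the 2-category of bicategories, normal (strictly unit-preserving) homomorphisms, and icons, i.e. oplax transformations whose components on objects are identities. For a locally posetal bicategory $\mathcal B$ with a chosen composite $\varphi_{f_1,\dots,f_n}$ of every finite path, $\varphi_\emptyset=1$, *the double category of marked paths $\mathbf{Dbl}(\mathcal B)$* has as objects finite paths $A_0\xrightarrow{f_1}\cdots\xrightarrow{f_n}A_n$ in $\mathcal B$ with a marked index $i_0$,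 as horizontal arrows finite paths with two marked indices $i_0\le i_1$, a unique vertical arrow between objects with the same marked object $A_{i_0}$ and no others, and as double cells the 2-cells of $\mathcal B$ between the chosen composites of the parts of the paths between the marks. *$\mathsf{WGDbl}_{\rm ps}$* is the 2-category of weakly globular double categories, pseudo-functors and vertical transformations, that is, pseudonatural transformations between the horizontal nerves $\Delta^{op}\to\mathsf{Cat}$, and modifications. **Theorem.** For all choices above: 1. $\mathbf{Bic}(\mathbf C\{W\})$ and $\mathbf C(W^{-1})$ are equivalent in $\mathbf{Bicat}_{\rm icon}$. 2. More precisely, there are normal homomorphisms $\omega\colon\mathbf{Bic}(\mathbf C\{W\})\to\mathbf C(W^{-1})$, sending the component of $w\colon A\to B$ to $B$ and the arrow $B\xleftarrow{w}A\xrightarrow{f}A'\xrightarrow{w'}B'$ to $B\xleftarrow{w}A\xrightarrow{w'f}B'$, and $\alpha\colon\mathbf C(W^{-1})\to\mathbf{Bic}(\mathbf C\{W\})$, sending $A$ to the component of $1_A$ and $A\xleftarrow{w}S\xrightarrow{f}B$ to $A\xleftarrow{w}S\xrightarrow{f}B\xrightarrow{1_B}B$, such that $\omega\alpha=\mathrm{Id}$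 and there is an invertible icon $\alpha\omega\Rightarrow\mathrm{Id}$. 3. $\mathbf C(W^{-1})$ has at most one 2-cell between any two arrows. 4. $\mathbf C\{W\}$ and $\mathbf{Dbl}(\mathbf C(W^{-1}))$ are weakly globular, and they are equivalent in $\mathsf{WGDbl}_{\rm ps}$. -/

import Mathlib

open CategoryTheory

attribute [instance 2000] CategoryStruct.toQuiver

universe o h v c u w

/-- A (strict) double category: objects, horizontal arrows, vertical arrows and double cells.
In `Cell f g x y` the horizontal arrows `f` and `g` are the vertical domain (top) and codomain
(bottom), and the vertical arrows `x` and `y` are the horizontal domain (left) and codomain (right).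
All compositions are written in diagrammatic order. -/
structure DblCat where
  Obj : Type o
  Hor : Obj → Obj → Type h
  Ver : Obj → Obj → Type v
  Cell : ∀ {a b c d : Obj}, Hor a b → Hor c d → Ver a c → Ver b d → Type c
  hid : ∀ a, Hor a a
  hcomp : ∀ {a b c}, Hor a b → Hor b c → Hor a c
  vid : ∀ a, Ver a a
  vcomp : ∀ {a b c}, Ver a b → Ver b c → Ver a c
  /-- the vertical identity cell of a horizontal arrow -/
  cvid : ∀ {a b} (f : Hor a b), Cell f f (vid a) (vid b)
  /-- vertical composition of double cells -/
  cvcomp : ∀ {a b a' b' a'' b''} {f : Hor a b} {f' : Hor a' b'} {f'' : Hor a'' b''}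
    {x : Ver a a'} {y : Ver b b'} {x' : Ver a' a''} {y' : Ver b' b''},
    Cell f f' x y → Cell f' f'' x' y' → Cell f f'' (vcomp x x') (vcomp y y')
  /-- the horizontal identity cell of a vertical arrow -/
  chid : ∀ {a b} (x : Ver a b), Cell (hid a) (hid b) x x
  /-- horizontal composition of double cells -/
  chcomp : ∀ {a b c a' b' c'} {f : Hor a b} {g : Hor b c} {f' : Hor a' b'} {g' : Hor b' c'}
    {x : Ver a a'} {y : Ver b b'} {z : Ver c c'},
    Cell f f' x y → Cell g g' y z → Cell (hcomp f g) (hcomp f' g') x z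
  hid_hcomp : ∀ {a b} (f : Hor a b), hcomp (hid a) f = f
  hcomp_hid : ∀ {a b} (f : Hor a b), hcomp f (hid b) = f
  hassoc : ∀ {a b c d} (f : Hor a b) (g : Hor b c) (k : Hor c d),
    hcomp (hcomp f g) k = hcomp f (hcomp g k)
  vid_vcomp : ∀ {a b} (x : Ver a b), vcomp (vid a) x = x
  vcomp_vid : ∀ {a b} (x : Ver a b), vcomp x (vid b) = x
  vassoc : ∀ {a b c d} (x : Ver a b) (y : Ver b c) (z : Ver c d),
    vcomp (vcomp x y) z = vcomp x (vcomp y z)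
  cvid_cvcomp : ∀ {a b a' b'} {f : Hor a b} {f' : Hor a' b'} {x : Ver a a'} {y : Ver b b'}
    (α : Cell f f' x y), HEq (cvcomp (cvid f) α) α
  cvcomp_cvid : ∀ {a b a' b'} {f : Hor a b} {f' : Hor a' b'} {x : Ver a a'} {y : Ver b b'}
    (α : Cell f f' x y), HEq (cvcomp α (cvid f')) α
  cvassoc : ∀ {a b a' b' a'' b'' a₃ b₃} {f : Hor a b} {f' : Hor a' b'} {f'' : Hor a'' b''}
    {f₃ : Hor a₃ b₃} {x : Ver a a'} {y : Ver b b'} {x' : Ver a' a''} {y' : Ver b' b''}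
    {x'' : Ver a'' a₃} {y'' : Ver b'' b₃}
    (α : Cell f f' x y) (β : Cell f' f'' x' y') (γ : Cell f'' f₃ x'' y''),
    HEq (cvcomp (cvcomp α β) γ) (cvcomp α (cvcomp β γ))
  chid_chcomp : ∀ {a b a' b'} {f : Hor a b} {f' : Hor a' b'} {x : Ver a a'} {y : Ver b b'}
    (α : Cell f f' x y), HEq (chcomp (chid x) α) α
  chcomp_chid : ∀ {a b a' b'} {f : Hor a b} {f' : Hor a' b'} {x : Ver a a'} {y : Ver b b'}
    (α : Cell f f' x y), HEq (chcomp α (chid y)) α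
  chassoc : ∀ {a b c d a' b' c' d'} {f : Hor a b} {g : Hor b c} {k : Hor c d}
    {f' : Hor a' b'} {g' : Hor b' c'} {k' : Hor c' d'}
    {x : Ver a a'} {y : Ver b b'} {z : Ver c c'} {t : Ver d d'}
    (α : Cell f f' x y) (β : Cell g g' y z) (γ : Cell k k' z t),
    HEq (chcomp (chcomp α β) γ) (chcomp α (chcomp β γ))
  chcomp_cvid : ∀ {a b c} (f : Hor a b) (g : Hor b c),
    chcomp (cvid f) (cvid g) = cvid (hcomp f g)
  cvcomp_chid : ∀ {a b c} (x : Ver a b) (y : Ver b c),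
    cvcomp (chid x) (chid y) = chid (vcomp x y)
  chid_vid : ∀ a, chid (vid a) = cvid (hid a)
  interchange : ∀ {a b c a' b' c' a'' b'' c''} {f : Hor a b} {g : Hor b c} {f' : Hor a' b'}
    {g' : Hor b' c'} {f'' : Hor a'' b''} {g'' : Hor b'' c''}
    {x : Ver a a'} {y : Ver b b'} {z : Ver c c'} {x' : Ver a' a''} {y' : Ver b' b''}
    {z' : Ver c' c''} (α : Cell f f' x y) (β : Cell g g' y z)
    (α' : Cell f' f'' x' y') (β' : Cell g' g'' y' z'),
    cvcomp (chcomp α β) (chcomp α' β') = chcomp (cvcomp α α') (cvcomp β β')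

namespace DblCat

variable (X : DblCat.{o, h, v, c})

/-- The category `X₀` of objects and vertical arrows. -/
instance : Category X.Obj where
  Hom a b := X.Ver a b
  id a := X.vid a
  comp x y := X.vcomp x y
  id_comp := X.vid_vcomp
  comp_id := X.vcomp_vid
  assoc := X.vassoc

/-- A horizontal arrow of a double category, together with its domain and codomain. -/
structure HArr where
  src : X.Obj
  tgt : X.Obj
  arr : X.Hor src tgt

variable {X} in
/-- A double cell with given vertical domain and codomain. -/
@[ext]
structure HArr.Hom (f g : X.HArr) where
  left : X.Ver f.src g.src
  right : X.Ver f.tgt g.tgt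
  cell : X.Cell f.arr g.arr left right

/-- The category `X₁` of horizontal arrows and double cells, with vertical composition. -/
instance : Category X.HArr where
  Hom f g := HArr.Hom f g
  id _ := ⟨X.vid _, X.vid _, X.cvid _⟩
  comp α β := ⟨X.vcomp α.left β.left, X.vcomp α.right β.right, X.cvcomp α.cell β.cell⟩
  id_comp _ := HArr.Hom.ext (X.vid_vcomp _) (X.vid_vcomp _) (X.cvid_cvcomp _)
  comp_id _ := HArr.Hom.ext (X.vcomp_vid _) (X.vcomp_vid _) (X.cvcomp_cvid _)
  assoc _ _ _ := HArr.Hom.ext (X.vassoc _ _ _) (X.vassoc _ _ _) (X.cvassoc _ _ _)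

/-- Path components of the vertical category `X₀`. -/
abbrev Comp : Type o := CategoryTheory.ConnectedComponents X.Obj

variable {X} in
/-- The path component of an object. -/
abbrev cc (a : X.Obj) : X.Comp := CategoryTheory.ConnectedComponents.mk a

section Diagrams

variable (J : Type u) [Category.{w} J]

/-- Diagrams of shape `J` of horizontal arrows, that is, functors from `J` to the category of
objects and horizontal arrows. -/
structure Diag where
  obj : J → X.Obj
  map : ∀ {i j : J}, (i ⟶ j) → X.Hor (obj i) (obj j)
  map_id : ∀ i : J, map (𝟙 i) = X.hid (obj i)
  map_comp : ∀ {i j k : J} (s : i ⟶ j) (t : j ⟶ k), map (s ≫ t) = X.hcomp (map s) (map t)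

variable {X J}

/-- A morphism of horizontal diagrams: vertical arrows, and double cells compatible with
horizontal identities and horizontal composition. -/
@[ext]
structure Diag.Hom (F G : Diag X J) where
  app : ∀ i : J, X.Ver (F.obj i) (G.obj i)
  cell : ∀ {i j : J} (s : i ⟶ j), X.Cell (F.map s) (G.map s) (app i) (app j)
  cell_id : ∀ i : J, HEq (cell (𝟙 i)) (X.chid (app i))
  cell_comp : ∀ {i j k : J} (s : i ⟶ j) (t : j ⟶ k),
    HEq (cell (s ≫ t)) (X.chcomp (cell s) (cell t))

theorem cvcomp_heq {a b a' b' a'' b'' : X.Obj} {f₁ f₂ : X.Hor a b} {f₁' f₂' : X.Hor a' b'}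
    {f₁'' f₂'' : X.Hor a'' b''} (e : f₁ = f₂) (e' : f₁' = f₂') (e'' : f₁'' = f₂'')
    {x : X.Ver a a'} {y : X.Ver b b'} {x' : X.Ver a' a''} {y' : X.Ver b' b''}
    {α₁ : X.Cell f₁ f₁' x y} {α₂ : X.Cell f₂ f₂' x y}
    {β₁ : X.Cell f₁' f₁'' x' y'} {β₂ : X.Cell f₂' f₂'' x' y'}
    (hα : HEq α₁ α₂) (hβ : HEq β₁ β₂) : HEq (X.cvcomp α₁ β₁) (X.cvcomp α₂ β₂) := by
  subst e e' e''
  obtain rfl := eq_of_heq hα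
  obtain rfl := eq_of_heq hβ
  rfl

theorem cvid_heq {a b : X.Obj} {f g : X.Hor a b} (e : f = g) :
    HEq (X.cvid f) (X.cvid g) := by subst e; rfl

theorem Diag.Hom.ext_heq {F G : Diag X J} {α β : Diag.Hom F G} (e : ∀ i, α.app i = β.app i)
    (e' : ∀ {i j : J} (s : i ⟶ j), HEq (α.cell s) (β.cell s)) : α = β := by
  obtain ⟨a, ac, _, _⟩ := α
  obtain ⟨b, bc, _, _⟩ := β
  obtain rfl : a = b := funext e
  obtain rfl : @ac = @bc := by
    funext i j s
    exact eq_of_heq (e' s)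
  rfl

/-- The identity morphism of a horizontal diagram. -/
def Diag.Hom.id (F : Diag X J) : Diag.Hom F F where
  app _ := X.vid _
  cell _ := X.cvid _
  cell_id i := by
    rw [X.chid_vid]
    exact cvid_heq (F.map_id i)
  cell_comp s t := by
    rw [X.chcomp_cvid]
    exact cvid_heq (F.map_comp s t)

/-- Vertical composition of morphisms of horizontal diagrams. -/
def Diag.Hom.comp {F G K : Diag X J} (α : Diag.Hom F G) (β : Diag.Hom G K) : Diag.Hom F K where
  app i := X.vcomp (α.app i) (β.app i)
  cell s := X.cvcomp (α.cell s) (β.cell s)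
  cell_id i := by
    rw [← X.cvcomp_chid]
    exact cvcomp_heq (F.map_id i) (G.map_id i) (K.map_id i) (α.cell_id i) (β.cell_id i)
  cell_comp s t := by
    rw [← X.interchange]
    exact cvcomp_heq (F.map_comp s t) (G.map_comp s t) (K.map_comp s t)
      (α.cell_comp s t) (β.cell_comp s t)

instance Diag.category : Category (Diag X J) where
  Hom F G := Diag.Hom F G
  id F := Diag.Hom.id F
  comp α β := Diag.Hom.comp α β
  id_comp α := Diag.Hom.ext_heq (fun _ => X.vid_vcomp _) (fun s => X.cvid_cvcomp (α.cell s))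
  comp_id α := Diag.Hom.ext_heq (fun _ => X.vcomp_vid _) (fun s => X.cvcomp_cvid (α.cell s))
  assoc α β γ := Diag.Hom.ext_heq (fun _ => X.vassoc _ _ _)
    (fun s => X.cvassoc (α.cell s) (β.cell s) (γ.cell s))

theorem cell_congr {F G : Diag X J} (α : Diag.Hom F G) {i j : J} {s t : i ⟶ j} (e : s = t) :
    HEq (α.cell s) (α.cell t) := by subst e; rfl

variable (X) in
/-- Restriction of horizontal diagrams along a functor of index categories. -/
def Diag.restrict {J' : Type u} [Category.{w} J'] (K : J' ⥤ J) : Diag X J ⥤ Diag X J' where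
  obj F :=
    { obj := fun i => F.obj (K.obj i)
      map := fun s => F.map (K.map s)
      map_id := fun i => by rw [K.map_id, F.map_id]
      map_comp := fun s t => by rw [K.map_comp, F.map_comp] }
  map {F G} α :=
    { app := fun i => α.app (K.obj i)
      cell := fun s => α.cell (K.map s)
      cell_id := fun i => (cell_congr α (K.map_id i)).trans (α.cell_id (K.obj i))
      cell_comp := fun s t =>
        (cell_congr α (K.map_comp s t)).trans (α.cell_comp (K.map s) (K.map t)) }

end Diagrams

/-- The horizontal nerve of `X`. At level `n` it is the category
`X₁ ×_{X₀} ⋯ ×_{X₀} X₁` of chains of `n` composable horizontal arrows and horizontally composable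
chains of double cells, a chain being written as a functor out of the ordinal `[n]`. -/
def nerve : SimplexCategoryᵒᵖ ⥤ Cat.{max v c, max o h} where
  obj n := Cat.of (Diag X (Fin (n.unop.len + 1)))
  map θ := (Diag.restrict X θ.unop.toOrderHom.monotone.functor).toCatHom
  map_id _ := rfl
  map_comp _ _ := rfl

/-- The horizontal nerve as a pseudofunctor. -/
def nervePs : Pseudofunctor (LocallyDiscrete SimplexCategoryᵒᵖ) Cat.{max v c, max o h} :=
  X.nerve.toPseudofunctor'

/-- The functor `γ : X₀ ⥤ X₀ᵈ` to the discrete category of path components of `X₀`. -/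
def toComp : X.Obj ⥤ Discrete X.Comp :=
  CategoryTheory.ConnectedComponents.functorToDiscrete _ id

/-- The families of `n` horizontal arrows whose consecutive ends lie in the same path component:
the objects of `X₁ ×_{X₀ᵈ} ⋯ ×_{X₀ᵈ} X₁`. -/
def segalProp (n : ℕ) : ObjectProperty (Fin n → X.HArr) :=
  fun F => ∀ i j : Fin n, i.val + 1 = j.val → cc (F i).tgt = cc (F j).src

/-- The Segal map `X₁ ×_{X₀} ⋯ ×_{X₀} X₁ ⥤ X₁ ×_{X₀ᵈ} ⋯ ×_{X₀ᵈ} X₁` induced by `γ`. -/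
def segal (n : ℕ) : Diag X (Fin (n + 1)) ⥤ (X.segalProp n).FullSubcategory :=
  (X.segalProp n).lift
    { obj := fun F k => ⟨F.obj k.castSucc, F.obj k.succ, F.map (homOfLE k.castSucc_le_succ)⟩
      map := fun α k => ⟨α.app k.castSucc, α.app k.succ, α.cell (homOfLE k.castSucc_le_succ)⟩
      map_id := fun _ => rfl
      map_comp := fun _ _ => rfl }
    (fun F i j e => by
      have : i.succ = j.castSucc := Fin.ext (by simpa using e)
      change cc (F.obj i.succ) = cc (F.obj j.castSucc)
      rw [this])

/-- A double category is weakly globular when `X₀` is equivalent to the discrete category of its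
path components, and the Segal maps over these components are equivalences of categories. -/
structure IsWeaklyGlobular : Prop where
  toComp_isEquivalence : X.toComp.IsEquivalence
  segal_isEquivalence : ∀ n, 2 ≤ n → (X.segal n).IsEquivalence

/-- There is at most one double cell in every frame of horizontal and vertical arrows. -/
class FrameThin : Prop where
  subsingleton : ∀ {a b c d : X.Obj} (f : X.Hor a b) (g : X.Hor c d) (x : X.Ver a c)
    (y : X.Ver b d), Subsingleton (X.Cell f g x y)

variable {X}

theorem cc_eq_of_ver {a b : X.Obj} (x : X.Ver a b) : cc a = cc b :=
  Quotient.sound (Relation.ReflTransGen.single (Or.inl ⟨x⟩))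

namespace IsWeaklyGlobular

theorem ver_eq (hX : X.IsWeaklyGlobular) {a b : X.Obj} (x y : X.Ver a b) : x = y := by
  have := hX.toComp_isEquivalence
  exact X.toComp.map_injective (X := a) (Y := b) (Subsingleton.elim _ _)

theorem exists_ver (hX : X.IsWeaklyGlobular) {a b : X.Obj} (e : cc a = cc b) :
    Nonempty (X.Ver a b) := by
  have := hX.toComp_isEquivalence
  exact ⟨X.toComp.preimage (X := a) (Y := b) (eqToHom (congrArg Discrete.mk e))⟩

theorem exists_chain (hX : X.IsWeaklyGlobular) {n : ℕ} (hn : 2 ≤ n) (F : Fin n → X.HArr)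
    (hF : X.segalProp n F) : ∃ D : Diag X (Fin (n + 1)), ∀ k : Fin n,
      Nonempty ((⟨D.obj k.castSucc, D.obj k.succ, D.map (homOfLE k.castSucc_le_succ)⟩ : X.HArr)
        ≅ F k) := by
  have := hX.segal_isEquivalence n hn
  refine ⟨(X.segal n).objPreimage ⟨F, hF⟩, fun k => ⟨?_⟩⟩
  exact (Pi.isoApp ((X.segalProp n).ι.mapIso ((X.segal n).objObjPreimageIso ⟨F, hF⟩)) k)

end IsWeaklyGlobular

/-- Given posetal groupoidal vertical arrows, and lifts of vertical arrows along the horizontal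
codomain, every family of matching horizontal arrows comes from a composable chain. -/
theorem exists_chain_of_lift
    (hinv : ∀ a b : X.Obj, X.Ver a b → X.Ver b a)
    (hcc : ∀ a b : X.Obj, cc a = cc b → Nonempty (X.Ver a b))
    (hlift : ∀ (g : X.HArr) (b : X.Obj), X.Ver b g.tgt →
      ∃ (a : X.Obj) (f : X.Hor a b), Nonempty ((⟨a, b, f⟩ : X.HArr) ≅ g)) (n : ℕ)
    (F : Fin (n + 1) → X.HArr) (hF : X.segalProp (n + 1) F) :
    ∃ (p : Fin (n + 2) → X.Obj) (m : ∀ k : Fin (n + 1), X.Hor (p k.castSucc) (p k.succ)),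
      ∀ k, Nonempty ((⟨_, _, m k⟩ : X.HArr) ≅ F k) := by
  induction n with
  | zero =>
    refine ⟨Fin.cons (F 0).src (fun _ => (F 0).tgt),
      Fin.cases (F 0).arr (fun i => i.elim0), fun k => ?_⟩
    obtain rfl : k = 0 := Fin.ext (by omega)
    exact ⟨Iso.refl (F 0)⟩
  | succ n ih =>
    obtain ⟨p, m, e⟩ := ih (fun k => F k.succ) (fun i j hij => hF _ _ (by simpa using hij))
    obtain ⟨e0⟩ := e 0
    obtain ⟨y⟩ := hcc (F 0).tgt (F 1).src (hF 0 1 rfl)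
    have y' : X.Ver (p 0) (F 0).tgt := X.vcomp e0.hom.left (hinv _ _ y)
    obtain ⟨a, f, ⟨i⟩⟩ := hlift (F 0) (p 0) y'
    refine ⟨Fin.cons a p, Fin.cases f m, fun k => ?_⟩
    induction k using Fin.cases with
    | zero => exact ⟨i⟩
    | succ k => exact e k

/-- The diagram given by a chain of composable horizontal arrows. -/
theorem exists_diag_of_chain {n : ℕ} (p : Fin (n + 1) → X.Obj)
    (m : ∀ k : Fin n, X.Hor (p k.castSucc) (p k.succ)) :
    ∃ D : Diag X (Fin (n + 1)), ∀ k : Fin n,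
      (⟨D.obj k.castSucc, D.obj k.succ, D.map (homOfLE k.castSucc_le_succ)⟩ : X.HArr)
        = ⟨_, _, m k⟩ := by
  let cat : Category X.Obj :=
    { Hom := X.Hor, id := X.hid, comp := X.hcomp, id_comp := X.hid_hcomp, comp_id := X.hcomp_hid,
      assoc := X.hassoc }
  let E := @ComposableArrows.mkOfObjOfMapSucc X.Obj cat n p m
  refine ⟨⟨E.obj, E.map, E.map_id, E.map_comp⟩, fun k => ?_⟩
  have h := @ComposableArrows.mkOfObjOfMapSucc_map_succ X.Obj cat n p m k.val k.isLt
  have h' : E.map (homOfLE k.castSucc_le_succ) = m k := h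
  change (⟨p k.castSucc, p k.succ, E.map (homOfLE k.castSucc_le_succ)⟩ : X.HArr) = _
  rw [h']

theorem cell_nonempty [X.FrameThin] (hsub : ∀ a b : X.Obj, Subsingleton (X.Ver a b)) {n : ℕ}
    {F G : Diag X (Fin (n + 1))} (app : ∀ i, X.Ver (F.obj i) (G.obj i))
    (φ : ∀ k, (X.segal n |>.obj F).obj k ⟶ (X.segal n |>.obj G).obj k)
    (i j : Fin (n + 1)) (s : i ⟶ j) :
    Nonempty (X.Cell (F.map s) (G.map s) (app i) (app j)) := by
  induction j using Fin.induction with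
  | zero =>
    obtain rfl : i = 0 := Fin.le_zero_iff.mp (leOfHom s)
    obtain rfl : s = 𝟙 _ := Subsingleton.elim _ _
    rw [F.map_id, G.map_id]
    exact ⟨X.chid _⟩
  | succ k ih =>
    by_cases h : i = k.succ
    · subst h
      obtain rfl : s = 𝟙 _ := Subsingleton.elim _ _
      rw [F.map_id, G.map_id]
      exact ⟨X.chid _⟩
    · have hik : i ≤ k.castSucc := by
        have h1 := leOfHom s
        rw [Fin.le_def] at h1 ⊢
        have h2 : i.val ≠ k.succ.val := fun e => h (Fin.ext e)
        simp only [Fin.val_succ, Fin.val_castSucc] at h1 h2 ⊢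
        omega
      obtain ⟨α⟩ := ih (homOfLE hik)
      have e1 : app k.castSucc = (φ k).left := (hsub _ _).elim _ _
      have e2 : app k.succ = (φ k).right := (hsub _ _).elim _ _
      obtain rfl : s = homOfLE hik ≫ homOfLE k.castSucc_le_succ := Subsingleton.elim _ _
      rw [F.map_comp, G.map_comp]
      have β : X.Cell (F.map (homOfLE k.castSucc_le_succ)) (G.map (homOfLE k.castSucc_le_succ))
          (app k.castSucc) (app k.succ) := by
        rw [e1, e2]
        exact (φ k).cell
      exact ⟨X.chcomp α β⟩

theorem FrameThin.heq [X.FrameThin] {a b c d : X.Obj} {f f' : X.Hor a b} {g g' : X.Hor c d}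
    {x : X.Ver a c} {y : X.Ver b d} (e : f = f') (e' : g = g') (α : X.Cell f g x y)
    (β : X.Cell f' g' x y) : HEq α β := by
  subst e e'
  have := FrameThin.subsingleton f g x y
  exact heq_of_eq (Subsingleton.elim _ _)

/-- If the vertical arrows are posetal and groupoidal, and the horizontal codomain functor
`X₁ ⥤ X₀` is an isofibration, then `X` is weakly globular. -/
theorem IsWeaklyGlobular.of_isofibration [X.FrameThin]
    (hsub : ∀ a b : X.Obj, Subsingleton (X.Ver a b))
    (hinv : ∀ a b : X.Obj, X.Ver a b → X.Ver b a)
    (hlift : ∀ (g : X.HArr) (b : X.Obj), X.Ver b g.tgt →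
      ∃ (a : X.Obj) (f : X.Hor a b), Nonempty ((⟨a, b, f⟩ : X.HArr) ≅ g)) :
    X.IsWeaklyGlobular := by
  have hcc : ∀ a b : X.Obj, cc a = cc b → Nonempty (X.Ver a b) := by
    intro a b e
    have z : Zigzag a b := Quotient.exact e
    induction z with
    | refl => exact ⟨X.vid a⟩
    | tail _ h ih =>
      obtain ⟨x⟩ := ih (Quotient.sound (by assumption))
      rcases h with ⟨⟨y⟩⟩ | ⟨⟨y⟩⟩
      · exact ⟨X.vcomp x y⟩
      · exact ⟨X.vcomp x (hinv _ _ y)⟩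
  refine ⟨?_, fun n hn => ?_⟩
  · refine { faithful := ⟨fun _ => (hsub _ _).elim _ _⟩, full := ⟨fun {a b} f => ?_⟩,
             essSurj := ⟨fun d => ?_⟩ }
    · obtain ⟨x⟩ := hcc a b (congrArg id (Discrete.eq_of_hom f))
      exact ⟨x, Subsingleton.elim _ _⟩
    · obtain ⟨d⟩ := d
      induction d using Quotient.inductionOn with
      | h a => exact ⟨a, ⟨Iso.refl _⟩⟩
  · refine { faithful := ⟨fun {F G} α β _ => ?_⟩, full := ⟨fun {F G} φ => ?_⟩,
             essSurj := ⟨fun d => ?_⟩ }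
    · refine Diag.Hom.ext_heq (fun i => (hsub _ _).elim _ _) (fun s => ?_)
      obtain ⟨a, ac, _, _⟩ := α
      obtain ⟨b, bc, _, _⟩ := β
      obtain rfl : a = b := funext fun i => (hsub _ _).elim _ _
      exact FrameThin.heq rfl rfl _ _
    · have happ : ∀ i, Nonempty (X.Ver (F.obj i) (G.obj i)) := by
        intro i
        induction i using Fin.lastCases with
        | last =>
          obtain ⟨m, rfl⟩ : ∃ m, n = m + 1 := ⟨n - 1, by omega⟩
          exact ⟨(φ.hom (Fin.last m)).right⟩
        | cast k => exact ⟨(φ.hom k).left⟩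
      have app := fun i => (happ i).some
      have cell := fun i j s => (cell_nonempty hsub app (fun k => φ.hom k) i j s).some
      refine ⟨⟨app, fun {i j} s => cell i j s, fun i => ?_, fun s t => ?_⟩, ?_⟩
      · exact FrameThin.heq (F.map_id i) (G.map_id i) _ _
      · exact FrameThin.heq (F.map_comp s t) (G.map_comp s t) _ _
      · apply ObjectProperty.hom_ext
        funext k
        exact HArr.Hom.ext ((hsub _ _).elim _ _) ((hsub _ _).elim _ _) (by
          have e1 := (hsub _ _).elim (app k.castSucc) (φ.hom k).left
          have e2 := (hsub _ _).elim (app k.succ) (φ.hom k).right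
          have key : ∀ {x x' : X.Ver _ _} {y y' : X.Ver _ _} (_ : x = x') (_ : y = y')
              (α : X.Cell (F.map (homOfLE k.castSucc_le_succ))
                (G.map (homOfLE k.castSucc_le_succ)) x y)
              (β : X.Cell (F.map (homOfLE k.castSucc_le_succ))
                (G.map (homOfLE k.castSucc_le_succ)) x' y'), HEq α β := by
            intro x x' y y' h h' α β
            subst h h'
            exact FrameThin.heq rfl rfl _ _
          exact key e1 e2 _ _)
    · obtain ⟨m, rfl⟩ : ∃ m, n = m + 1 := ⟨n - 1, by omega⟩
      obtain ⟨p, a, e⟩ := exists_chain_of_lift hinv hcc hlift m d.obj d.property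
      obtain ⟨D, hD⟩ := exists_diag_of_chain p a
      refine ⟨D, ⟨ObjectProperty.isoMk _ (Pi.isoMk fun k => ?_)⟩⟩
      exact eqToIso (hD k) ≪≫ (e k).some
section FundamentalBicategory

/-- A strictly composable pair of horizontal arrows, isomorphic in `X₁` to two given ones. -/
structure Composite (f g : X.HArr) where
  {a b c : X.Obj}
  fst : X.Hor a b
  snd : X.Hor b c
  isoFst : (⟨a, b, fst⟩ : X.HArr) ≅ f
  isoSnd : (⟨b, c, snd⟩ : X.HArr) ≅ g

variable (X)

/-- A choice, for all pairs of horizontal arrows in `X₁ ×_{X₀ᵈ} X₁`, of an isomorphic pair in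
`X₁ ×_{X₀} X₁`: the objects and the isomorphisms of a pseudo-inverse of the Segal map. -/
def SegalChoice := ∀ f g : X.HArr, cc f.tgt = cc g.src → Composite f g

/-- A choice of a representing object in every path component. -/
structure RepChoice where
  rep : X.Comp → X.Obj
  cc_rep : ∀ a, cc (rep a) = a

variable {X}

theorem IsWeaklyGlobular.nonempty_segalChoice (hX : X.IsWeaklyGlobular) :
    Nonempty X.SegalChoice := by
  refine ⟨fun f g e => Classical.choice ?_⟩
  obtain ⟨D, hD⟩ := hX.exists_chain (n := 2) le_rfl ![f, g] (by
    intro i j hij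
    fin_cases i <;> fin_cases j <;> simp_all)
  exact ⟨⟨_, _, (hD 0).some, (hD 1).some⟩⟩

/-- Horizontal pasting of double cells between composable horizontal arrows. The two vertical
arrows in the middle agree, as vertical arrows are determined by their ends. -/
def paste (hX : X.IsWeaklyGlobular) {a b c a' b' c' : X.Obj} {f : X.Hor a b} {g : X.Hor b c}
    {f' : X.Hor a' b'} {g' : X.Hor b' c'}
    (α : (⟨a, b, f⟩ : X.HArr) ⟶ ⟨a', b', f'⟩) (β : (⟨b, c, g⟩ : X.HArr) ⟶ ⟨b', c', g'⟩) :
    (⟨a, c, X.hcomp f g⟩ : X.HArr) ⟶ ⟨a', c', X.hcomp f' g'⟩ :=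
  ⟨α.left, β.right, X.chcomp α.cell (hX.ver_eq β.left α.right ▸ β.cell)⟩

theorem harr_hom_eq (hX : X.IsWeaklyGlobular) [X.FrameThin] {f g : X.HArr} (α β : f ⟶ g) :
    α = β := by
  obtain ⟨l, r, s⟩ := α
  obtain ⟨l', r', s'⟩ := β
  obtain rfl := hX.ver_eq l l'
  obtain rfl := hX.ver_eq r r'
  have := FrameThin.subsingleton f.arr g.arr l r
  obtain rfl := Subsingleton.elim s s'
  rfl

/-- Horizontal pasting of vertically invertible double cells. -/
def pasteIso (hX : X.IsWeaklyGlobular) [X.FrameThin] {a b c a' b' c' : X.Obj} {f : X.Hor a b}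
    {g : X.Hor b c} {f' : X.Hor a' b'} {g' : X.Hor b' c'}
    (α : (⟨a, b, f⟩ : X.HArr) ≅ ⟨a', b', f'⟩) (β : (⟨b, c, g⟩ : X.HArr) ≅ ⟨b', c', g'⟩) :
    (⟨a, c, X.hcomp f g⟩ : X.HArr) ≅ ⟨a', c', X.hcomp f' g'⟩ where
  hom := paste hX α.hom β.hom
  inv := paste hX α.inv β.inv
  hom_inv_id := harr_hom_eq hX _ _
  inv_hom_id := harr_hom_eq hX _ _

/-- The isomorphism in `X₁` between horizontal identities given by a vertical arrow. -/
noncomputable def hidIso (hX : X.IsWeaklyGlobular) [X.FrameThin] {a b : X.Obj} (x : X.Ver a b) :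
    (⟨a, a, X.hid a⟩ : X.HArr) ≅ ⟨b, b, X.hid b⟩ where
  hom := ⟨x, x, X.chid x⟩
  inv :=
    let y := (hX.exists_ver (cc_eq_of_ver x).symm).some
    ⟨y, y, X.chid y⟩
  hom_inv_id := harr_hom_eq hX _ _
  inv_hom_id := harr_hom_eq hX _ _

/-- The fundamental bicategory of a weakly globular double category (with at most one double cell
per frame): its objects are the path components of the vertical category. The units are the
horizontal identities of the chosen representatives of the components. -/
structure Bic (hX : X.IsWeaklyGlobular) (r : X.RepChoice) (M : X.SegalChoice) : Type o where
  comp : X.Comp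

namespace Bic

variable {hX : X.IsWeaklyGlobular} {r : X.RepChoice} {M : X.SegalChoice}

/-- Arrows of the fundamental bicategory: all horizontal arrows between objects of the two
components. -/
structure Hom (a b : Bic hX r M) where
  arr : X.HArr
  src_eq : cc arr.src = a.comp
  tgt_eq : cc arr.tgt = b.comp

/-- The 2-cells are the double cells, composed vertically. -/
instance (a b : Bic hX r M) : Category (Hom a b) where
  Hom f g := f.arr ⟶ g.arr
  id f := 𝟙 f.arr
  comp α β := α ≫ β

/-- The chosen strictly composable replacement of a pair of arrows. -/
def replace {a b c : Bic hX r M} (f : Hom a b) (g : Hom b c) : Composite f.arr g.arr :=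
  M f.arr g.arr (f.tgt_eq.trans g.src_eq.symm)

instance : CategoryStruct (Bic hX r M) where
  Hom a b := Hom a b
  id a := ⟨⟨r.rep a.comp, r.rep a.comp, X.hid _⟩, r.cc_rep _, r.cc_rep _⟩
  comp f g :=
    { arr := ⟨_, _, X.hcomp (replace f g).fst (replace f g).snd⟩
      src_eq := (cc_eq_of_ver (replace f g).isoFst.hom.left).trans f.src_eq
      tgt_eq := (cc_eq_of_ver (replace f g).isoSnd.hom.right).trans g.tgt_eq }

instance (a b : Bic hX r M) : Category (a ⟶ b) := inferInstanceAs (Category (Hom a b))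

variable [X.FrameThin]

theorem two_cell_eq {a b : Bic hX r M} {f g : a ⟶ b} (α β : f ⟶ g) : α = β :=
  harr_hom_eq hX (f := Hom.arr f) (g := Hom.arr g) α β

/-- An isomorphism in `X₁` is an invertible 2-cell. -/
def mkIso {a b : Bic hX r M} {f g : a ⟶ b} (e : Hom.arr f ≅ Hom.arr g) : f ≅ g where
  hom := e.hom
  inv := e.inv
  hom_inv_id := two_cell_eq _ _
  inv_hom_id := two_cell_eq _ _

theorem nonempty_leftUnitor {a b : Bic hX r M} (f : a ⟶ b) : Nonempty (𝟙 a ≫ f ≅ f) := by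
  obtain ⟨F, hs, ht⟩ := f
  obtain ⟨x⟩ := hX.exists_ver ((r.cc_rep a.comp).trans hs.symm)
  let m : Composite ⟨_, _, X.hid (r.rep a.comp)⟩ F :=
    replace (𝟙 a : a ⟶ a) (⟨F, hs, ht⟩ : Hom a b)
  exact ⟨mkIso (pasteIso hX (m.isoFst ≪≫ hidIso hX x) m.isoSnd ≪≫
    eqToIso (congrArg (HArr.mk F.src F.tgt) (X.hid_hcomp F.arr)))⟩

theorem nonempty_rightUnitor {a b : Bic hX r M} (f : a ⟶ b) : Nonempty (f ≫ 𝟙 b ≅ f) := by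
  obtain ⟨F, hs, ht⟩ := f
  obtain ⟨x⟩ := hX.exists_ver ((r.cc_rep b.comp).trans ht.symm)
  let m : Composite F ⟨_, _, X.hid (r.rep b.comp)⟩ :=
    replace (⟨F, hs, ht⟩ : Hom a b) (𝟙 b : b ⟶ b)
  exact ⟨mkIso (pasteIso hX m.isoFst (m.isoSnd ≪≫ hidIso hX x) ≪≫
    eqToIso (congrArg (HArr.mk F.src F.tgt) (X.hcomp_hid F.arr)))⟩

theorem nonempty_associator {a b c d : Bic hX r M} (f : a ⟶ b) (g : b ⟶ c) (k : c ⟶ d) :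
    Nonempty ((f ≫ g) ≫ k ≅ f ≫ (g ≫ k)) := by
  obtain ⟨D, hD⟩ := hX.exists_chain (n := 3) (by omega) ![Hom.arr f, Hom.arr g, Hom.arr k] (by
    have h1 : cc (Hom.arr f).tgt = cc (Hom.arr g).src := (Hom.tgt_eq f).trans (Hom.src_eq g).symm
    have h2 : cc (Hom.arr g).tgt = cc (Hom.arr k).src := (Hom.tgt_eq g).trans (Hom.src_eq k).symm
    intro i j hij
    fin_cases i <;> fin_cases j <;> first | exact h1 | exact h2 | simp at hij)
  have e1 := (hD 0).some
  have e2 := (hD 1).some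
  have e3 := (hD 2).some
  let m := replace f g
  let m' := replace (f ≫ g) k
  let n := replace g k
  let n' := replace f (g ≫ k)
  have i1 := pasteIso hX (m.isoFst ≪≫ e1.symm) (m.isoSnd ≪≫ e2.symm)
  have i2 := pasteIso hX (m'.isoFst ≪≫ i1) (m'.isoSnd ≪≫ e3.symm)
  have j1 := pasteIso hX (n.isoFst ≪≫ e2.symm) (n.isoSnd ≪≫ e3.symm)
  have j2 := pasteIso hX (n'.isoFst ≪≫ e1.symm) (n'.isoSnd ≪≫ j1)
  exact ⟨mkIso (i2 ≪≫ eqToIso (congrArg (HArr.mk _ _) (X.hassoc _ _ _)) ≪≫ j2.symm)⟩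

/-- The structure of a bicategory. Horizontal composites of 2-cells are obtained by pasting with
the chosen isomorphisms; the associators and unitors are the only 2-cells there are. -/
noncomputable instance : Bicategory (Bic hX r M) where
  whiskerLeft f g g' β := paste hX ((replace f g).isoFst.hom ≫ (replace f g').isoFst.inv)
    ((replace f g).isoSnd.hom ≫ β ≫ (replace f g').isoSnd.inv)
  whiskerRight {_ _ _ f f'} α g :=
    paste hX ((replace f g).isoFst.hom ≫ α ≫ (replace f' g).isoFst.inv)
      ((replace f g).isoSnd.hom ≫ (replace f' g).isoSnd.inv)
  associator f g k := (nonempty_associator f g k).some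
  leftUnitor f := (nonempty_leftUnitor f).some
  rightUnitor f := (nonempty_rightUnitor f).some
  whiskerLeft_id f g := two_cell_eq (f := f ≫ g) (g := f ≫ g) _ _
  whiskerLeft_comp f g _ k _ _ := two_cell_eq (f := f ≫ g) (g := f ≫ k) _ _
  id_whiskerLeft {_ _ f g} _ := two_cell_eq (f := 𝟙 _ ≫ f) (g := 𝟙 _ ≫ g) _ _
  comp_whiskerLeft f g k k' _ := two_cell_eq (f := (f ≫ g) ≫ k) (g := (f ≫ g) ≫ k') _ _
  id_whiskerRight f g := two_cell_eq (f := f ≫ g) (g := f ≫ g) _ _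
  comp_whiskerRight {_ _ _ f _ k} _ _ g := two_cell_eq (f := f ≫ g) (g := k ≫ g) _ _
  whiskerRight_id {_ _ f g} _ := two_cell_eq (f := f ≫ 𝟙 _) (g := g ≫ 𝟙 _) _ _
  whiskerRight_comp {_ _ _ _ f f'} _ g k :=
    two_cell_eq (f := f ≫ g ≫ k) (g := f' ≫ g ≫ k) _ _
  whisker_assoc f g g' _ k := two_cell_eq (f := (f ≫ g) ≫ k) (g := (f ≫ g') ≫ k) _ _
  whisker_exchange {_ _ _ f g k k'} _ _ := two_cell_eq (f := f ≫ k) (g := g ≫ k') _ _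
  pentagon f g k l :=
    two_cell_eq (f := ((f ≫ g) ≫ k) ≫ l) (g := f ≫ g ≫ k ≫ l) _ _
  triangle f g := two_cell_eq (f := (f ≫ 𝟙 _) ≫ g) (g := f ≫ g) _ _

end Bic

end FundamentalBicategory

end DblCat

section Icons

open Bicategory

universe w₁ w₂ v₁ v₂ u₁ u₂

/-- Transport of an arrow of a bicategory along equalities of its ends. -/
def castHom {B : Type u₁} [Quiver.{v₁} B] {a b a' b' : B} (e : a = a') (e' : b = b') (f : a ⟶ b) :
    a' ⟶ b' := e ▸ e' ▸ f

/-- Transport of a 2-cell of a bicategory along equalities of objects. -/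
def castHom₂ {B : Type u₁} [Bicategory.{w₁, v₁} B] {a b a' b' : B} (e : a = a') (e' : b = b')
    {f g : a ⟶ b} (α : f ⟶ g) : castHom e e' f ⟶ castHom e e' g :=
  match a', b', e, e' with
  | _, _, rfl, rfl => α

theorem castHom_comp {B : Type u₁} [Bicategory.{w₁, v₁} B] {a b c a' b' c' : B} (e : a = a')
    (e' : b = b') (e'' : c = c') (f : a ⟶ b) (g : b ⟶ c) :
    castHom e e'' (f ≫ g) = castHom e e' f ≫ castHom e' e'' g := by
  subst e e' e''; rfl

theorem castHom_id {B : Type u₁} [Bicategory.{w₁, v₁} B] {a a' : B} (e : a = a') :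
    castHom e e (𝟙 a) = 𝟙 a' := by
  subst e; rfl

variable {B : Type u₁} [Bicategory.{w₁, v₁} B] {C : Type u₂} [Bicategory.{w₂, v₂} C]

/-- An icon `F ⇒ G` between normal homomorphisms: an oplax natural transformation whose components
on objects are identities. It exists only if `F` and `G` agree on objects, and it amounts to
2-cells `F f ⟶ G f` natural in `f` and compatible with units and composition. -/
structure Icon (F G : StrictlyUnitaryPseudofunctor B C) where
  obj_eq : ∀ a, F.obj a = G.obj a
  app : ∀ {a b : B} (f : a ⟶ b), castHom (obj_eq a) (obj_eq b) (F.map f) ⟶ G.map f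
  naturality : ∀ {a b : B} {f g : a ⟶ b} (η : f ⟶ g),
    castHom₂ (obj_eq a) (obj_eq b) (F.map₂ η) ≫ app g = app f ≫ G.map₂ η
  app_id : ∀ a : B, app (𝟙 a) = castHom₂ (obj_eq a) (obj_eq a) (F.mapId a).hom ≫
    eqToHom (castHom_id (obj_eq a)) ≫ (G.mapId a).inv
  app_comp : ∀ {a b c : B} (f : a ⟶ b) (g : b ⟶ c),
    app (f ≫ g) = castHom₂ (obj_eq a) (obj_eq c) (F.mapComp f g).hom ≫
      eqToHom (castHom_comp (obj_eq a) (obj_eq b) (obj_eq c) (F.map f) (F.map g)) ≫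
      (app f ▷ castHom (obj_eq b) (obj_eq c) (F.map g)) ≫ (G.map f ◁ app g) ≫
      (G.mapComp f g).inv

/-- An icon is invertible (under vertical composition of icons) when all its components are. -/
def Icon.IsInvertible {F G : StrictlyUnitaryPseudofunctor B C} (η : Icon F G) : Prop :=
  ∀ {a b : B} (f : a ⟶ b), IsIso (η.app f)

variable (B C) in
/-- Equivalence in the 2-category of bicategories, normal homomorphisms and icons: normal
homomorphisms in both directions, whose composites are isomorphic to the identities by
invertible icons. -/
def IconEquivalent : Prop :=
  ∃ (F : StrictlyUnitaryPseudofunctor B C) (G : StrictlyUnitaryPseudofunctor C B),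
    (∃ η : Icon (F.comp G) (StrictlyUnitaryPseudofunctor.id B), η.IsInvertible) ∧
    (∃ θ : Icon (G.comp F) (StrictlyUnitaryPseudofunctor.id C), θ.IsInvertible)

end Icons

section Fractions

open MorphismProperty

variable {C : Type u} [Category.{v} C] {W : MorphismProperty C}

variable (W) in
/-- A choice, for every cospan whose right leg is in `W`, of a commutative square
`ψ.s ≫ φ.f = ψ.f ≫ φ.s` with `ψ.s` in `W`. -/
structure ChosenSquares where
  sq : ∀ {X Y : C}, W.LeftFraction X Y → W.RightFraction X Y
  comm : ∀ {X Y : C} (φ : W.LeftFraction X Y), (sq φ).s ≫ φ.f = (sq φ).f ≫ φ.s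

theorem nonempty_chosenSquares [W.HasRightCalculusOfFractions] : Nonempty (ChosenSquares W) :=
  ⟨⟨fun φ => φ.exists_rightFraction.choose, fun φ => φ.exists_rightFraction.choose_spec⟩⟩

/-- Representatives of 2-cells between two spans with left legs in `W`: commutative diagrams
`σ ⟵ T ⟶ τ` whose common left leg is in `W`. -/
structure SpanDiagram {A B : C} (σ τ : W.RightFraction A B) where
  {T : C}
  u₁ : T ⟶ σ.X'
  u₂ : T ⟶ τ.X'
  left : u₁ ≫ σ.s = u₂ ≫ τ.s
  right : u₁ ≫ σ.f = u₂ ≫ τ.f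
  mem : W (u₁ ≫ σ.s)

/-- Two diagrams represent the same 2-cell when they have a common refinement. -/
def SpanDiagram.Rel {A B : C} {σ τ : W.RightFraction A B} (φ ψ : SpanDiagram σ τ) : Prop :=
  ∃ (T : C) (t : T ⟶ φ.T) (t' : T ⟶ ψ.T), t ≫ φ.u₁ = t' ≫ ψ.u₁ ∧ t ≫ φ.u₂ = t' ≫ ψ.u₂ ∧
    W (t ≫ φ.u₁ ≫ σ.s)

/-- 2-cells between spans: equivalence classes of diagrams. -/
def SpanCell {A B : C} (σ τ : W.RightFraction A B) := Quot (SpanDiagram.Rel (σ := σ) (τ := τ))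

/-- The arrow of the localization defined by a span. -/
noncomputable def spanMap [W.HasRightCalculusOfFractions] {A B : C} (σ : W.RightFraction A B) :
    W.Q.obj A ⟶ W.Q.obj B := σ.map W.Q (Localization.inverts W.Q W)

theorem spanMap_eq [W.HasRightCalculusOfFractions] {A B X : C} (s : X ⟶ A) (hs : W s)
    (f : X ⟶ B) :
    spanMap (RightFraction.mk s hs f) =
      (Localization.isoOfHom W.Q W s hs).inv ≫ W.Q.map f := by
  rw [Iso.eq_inv_comp]
  exact RightFraction.map_s_comp_map (RightFraction.mk s hs f) W.Q (Localization.inverts W.Q W)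

/-- Any two diagrams between the same spans represent the same 2-cell. -/
theorem SpanDiagram.rel [W.HasRightCalculusOfFractions] {A B : C} {σ τ : W.RightFraction A B}
    (φ ψ : SpanDiagram σ τ) : SpanDiagram.Rel φ ψ := by
  obtain ⟨r, hr⟩ := LeftFraction.exists_rightFraction
    (LeftFraction.mk (φ.u₁ ≫ σ.s) (ψ.u₁ ≫ σ.s) ψ.mem)
  dsimp at hr
  obtain ⟨X, t, ht, e⟩ := HasRightCalculusOfFractions.ext (W := W) (r.s ≫ φ.u₁) (r.f ≫ ψ.u₁) σ.s
    σ.hs (by simpa using hr)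
  obtain ⟨Y, t', ht', e'⟩ := HasRightCalculusOfFractions.ext (W := W)
    (t ≫ r.s ≫ φ.u₂) (t ≫ r.f ≫ ψ.u₂) τ.s τ.hs (by
      simp only [Category.assoc, ← φ.left, ← ψ.left, hr])
  refine ⟨Y, t' ≫ t ≫ r.s, t' ≫ t ≫ r.f, ?_, ?_, ?_⟩
  · simp only [Category.assoc, e]
  · simpa only [Category.assoc] using e'
  · simp only [Category.assoc]
    exact W.comp_mem _ _ ht' (W.comp_mem _ _ ht (W.comp_mem _ _ r.hs φ.mem))

/-- There is at most one 2-cell between two spans. -/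
theorem SpanCell.eq [W.HasRightCalculusOfFractions] {A B : C} {σ τ : W.RightFraction A B}
    (φ ψ : SpanCell σ τ) : φ = ψ := by
  induction φ using Quot.inductionOn with
  | h φ =>
    induction ψ using Quot.inductionOn with
    | h ψ => exact Quot.sound (SpanDiagram.rel φ ψ)

theorem SpanCell.nonempty_iff [W.HasRightCalculusOfFractions] {A B : C}
    {σ τ : W.RightFraction A B} : Nonempty (SpanCell σ τ) ↔ spanMap σ = spanMap τ := by
  rw [spanMap, spanMap, RightFraction.map_eq_iff]
  constructor
  · rintro ⟨φ⟩
    induction φ using Quot.inductionOn with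
    | h φ => exact ⟨φ.T, φ.u₁, φ.u₂, φ.left, φ.right, φ.mem⟩
  · rintro ⟨T, u₁, u₂, hl, hr, hm⟩
    exact ⟨Quot.mk _ ⟨u₁, u₂, hl, hr, hm⟩⟩

/-- The 2-cell between two spans which define the same arrow of the localization. -/
noncomputable def SpanCell.ofEq [W.HasRightCalculusOfFractions] {A B : C}
    {σ τ : W.RightFraction A B} (e : spanMap σ = spanMap τ) : SpanCell σ τ :=
  (SpanCell.nonempty_iff.2 e).some

theorem SpanCell.spanMap_eq [W.HasRightCalculusOfFractions] {A B : C}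
    {σ τ : W.RightFraction A B} (φ : SpanCell σ τ) : spanMap σ = spanMap τ :=
  SpanCell.nonempty_iff.1 ⟨φ⟩

/-- The bicategory of fractions `C(W⁻¹)`: its objects are those of `C`, its arrows `A ⟶ B` are
spans `A ⟵ S ⟶ B` with left leg in `W`, composed by means of chosen squares, and its 2-cells are
equivalence classes of diagrams between spans. -/
structure Frac (S : ChosenSquares W) : Type u where
  as : C

namespace Frac

variable {S : ChosenSquares W} [W.HasRightCalculusOfFractions]

instance : CategoryStruct (Frac S) where
  Hom A B := W.RightFraction A.as B.as
  id A := RightFraction.mk (𝟙 A.as) (W.id_mem _) (𝟙 A.as)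
  comp {_ B _} σ τ :=
    let ψ := S.sq (LeftFraction.mk (Y' := B.as) σ.f τ.s τ.hs)
    RightFraction.mk (ψ.s ≫ σ.s) (W.comp_mem _ _ ψ.hs σ.hs) (ψ.f ≫ τ.f)

theorem spanMap_id (A : Frac S) :
    spanMap (W := W) (A := A.as) (B := A.as) (𝟙 A : A ⟶ A) = 𝟙 _ := by
  change spanMap (RightFraction.mk (𝟙 A.as) (W.id_mem _) (𝟙 A.as)) = _
  rw [spanMap_eq, Iso.inv_comp_eq]
  simp

theorem spanMap_comp {A B D : Frac S} (σ : A ⟶ B) (τ : B ⟶ D) :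
    spanMap (W := W) (A := A.as) (B := D.as) (σ ≫ τ) =
      spanMap (W := W) (A := A.as) (B := B.as) σ ≫
        spanMap (W := W) (A := B.as) (B := D.as) τ := by
  obtain ⟨s, hs, f⟩ := σ
  obtain ⟨s', hs', f'⟩ := τ
  let ψ := S.sq (LeftFraction.mk (Y' := B.as) f s' hs')
  have hψ : ψ.s ≫ f = ψ.f ≫ s' := S.comm (LeftFraction.mk (Y' := B.as) f s' hs')
  change spanMap (RightFraction.mk (ψ.s ≫ s) (W.comp_mem _ _ ψ.hs hs) (ψ.f ≫ f')) = _
  rw [spanMap_eq, spanMap_eq, spanMap_eq, Iso.inv_comp_eq]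
  have h : W.Q.map ψ.s ≫ W.Q.map f ≫ (Localization.isoOfHom W.Q W s' hs').inv = W.Q.map ψ.f := by
    rw [← Category.assoc, Iso.comp_inv_eq]
    simp only [← Functor.map_comp, hψ, Localization.isoOfHom_hom]
  simp only [Localization.isoOfHom_hom, Functor.map_comp, Category.assoc, ← h]
  have h2 : W.Q.map s ≫ (Localization.isoOfHom W.Q W s hs).inv = 𝟙 _ := by
    rw [Iso.comp_inv_eq]; simp
  rw [reassoc_of% h2]

/-- The category of spans and 2-cells between them; composition is the only one there is. -/
noncomputable instance (A B : Frac S) : Category (A ⟶ B) where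
  Hom σ τ := SpanCell (W := W) (A := A.as) (B := B.as) σ τ
  id _ := SpanCell.ofEq rfl
  comp φ ψ := SpanCell.ofEq (φ.spanMap_eq.trans ψ.spanMap_eq)
  id_comp _ := SpanCell.eq _ _
  comp_id _ := SpanCell.eq _ _
  assoc _ _ _ := SpanCell.eq _ _

/-- The bicategory of fractions is locally posetal. -/
theorem two_cell_eq {A B : Frac S} {σ τ : A ⟶ B} (φ ψ : σ ⟶ τ) : φ = ψ :=
  SpanCell.eq φ ψ

instance (A B : Frac S) : Quiver.IsThin (A ⟶ B) := fun _ _ => ⟨two_cell_eq⟩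

/-- The arrow of the localization defined by an arrow of the bicategory of fractions. -/
noncomputable def toLoc {A B : Frac S} (σ : A ⟶ B) : W.Q.obj A.as ⟶ W.Q.obj B.as :=
  spanMap (W := W) (A := A.as) (B := B.as) σ

theorem toLoc_id (A : Frac S) : toLoc (𝟙 A) = 𝟙 _ := spanMap_id A

theorem toLoc_comp {A B D : Frac S} (σ : A ⟶ B) (τ : B ⟶ D) :
    toLoc (σ ≫ τ) = toLoc σ ≫ toLoc τ := spanMap_comp σ τ

theorem toLoc_eq {A B : Frac S} {σ τ : A ⟶ B} (φ : σ ⟶ τ) : toLoc σ = toLoc τ :=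
  SpanCell.spanMap_eq φ

/-- The unique 2-cell between two arrows with the same image in the localization. -/
noncomputable def mk₂ {A B : Frac S} {σ τ : A ⟶ B} (e : toLoc σ = toLoc τ) : σ ⟶ τ :=
  SpanCell.ofEq e

/-- The unique invertible 2-cell between two arrows with the same image in the localization. -/
noncomputable def mkIso {A B : Frac S} {σ τ : A ⟶ B} (e : toLoc σ = toLoc τ) : σ ≅ τ where
  hom := mk₂ e
  inv := mk₂ e.symm
  hom_inv_id := two_cell_eq _ _
  inv_hom_id := two_cell_eq _ _

/-- The structure of a bicategory; all structure 2-cells are the only ones there are. -/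
noncomputable instance : Bicategory (Frac S) where
  whiskerLeft σ τ τ' ψ := mk₂ (σ := σ ≫ τ) (τ := σ ≫ τ') (by
    rw [toLoc_comp, toLoc_comp, toLoc_eq ψ])
  whiskerRight {_ _ _ σ σ'} φ τ := mk₂ (σ := σ ≫ τ) (τ := σ' ≫ τ) (by
    rw [toLoc_comp, toLoc_comp, toLoc_eq φ])
  associator σ τ υ := mkIso (σ := (σ ≫ τ) ≫ υ) (τ := σ ≫ τ ≫ υ) (by
    simp only [toLoc_comp, Category.assoc])
  leftUnitor {A _} σ := mkIso (σ := 𝟙 A ≫ σ) (τ := σ) (by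
    simp only [toLoc_comp, toLoc_id, Category.id_comp])
  rightUnitor {_ B} σ := mkIso (σ := σ ≫ 𝟙 B) (τ := σ) (by
    simp only [toLoc_comp, toLoc_id, Category.comp_id])
  whiskerLeft_id _ _ := two_cell_eq _ _
  whiskerLeft_comp _ _ _ _ _ _ := two_cell_eq _ _
  id_whiskerLeft _ := two_cell_eq _ _
  comp_whiskerLeft _ _ _ _ _ := two_cell_eq _ _
  id_whiskerRight _ _ := two_cell_eq _ _
  comp_whiskerRight _ _ _ := two_cell_eq _ _
  whiskerRight_id _ := two_cell_eq _ _
  whiskerRight_comp _ _ _ := two_cell_eq _ _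
  whisker_assoc _ _ _ _ _ := two_cell_eq _ _
  whisker_exchange _ _ := two_cell_eq _ _
  pentagon _ _ _ _ := two_cell_eq _ _
  triangle _ _ := two_cell_eq _ _

end Frac

end Fractions
section FractionsDoubleCategory

open MorphismProperty

variable {C : Type u} [Category.{v} C]

/-- An arrow `dom ⟶ cod` in `W`. -/
structure WArrow (W : MorphismProperty C) where
  {dom cod : C}
  hom : dom ⟶ cod
  mem : W hom

namespace WArrow

variable {W : MorphismProperty C}

/-- Representatives of vertical arrows from `X` to `Y`, which exist only if `X` and `Y` have the
same codomain: commutative diagrams `X.dom ⟵ T ⟶ Y.dom` over this codomain whose composite with `X`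
is in `W`. -/
structure VRep (X Y : WArrow W) where
  cod_eq : X.cod = Y.cod
  {T : C}
  u₁ : T ⟶ X.dom
  u₂ : T ⟶ Y.dom
  comm : u₁ ≫ X.hom ≫ eqToHom cod_eq = u₂ ≫ Y.hom
  mem : W (u₁ ≫ X.hom)

/-- Two diagrams represent the same vertical arrow when they have a common refinement. -/
def VRep.Rel {X Y : WArrow W} (p q : VRep X Y) : Prop :=
  ∃ (E : C) (r : E ⟶ p.T) (r' : E ⟶ q.T), r ≫ p.u₁ = r' ≫ q.u₁ ∧ r ≫ p.u₂ = r' ≫ q.u₂ ∧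
    W (r ≫ p.u₁ ≫ X.hom)

/-- Vertical arrows: equivalence classes of diagrams. -/
def Ver (X Y : WArrow W) := Quot (VRep.Rel (X := X) (Y := Y))

/-- The vertical arrow represented by a diagram. -/
def VRep.toVer {X Y : WArrow W} (p : VRep X Y) : Ver X Y := Quot.mk VRep.Rel p

/-- The representatives of a vertical arrow. -/
structure Ver.Rep {X Y : WArrow W} (x : Ver X Y) extends VRep X Y where
  toVer_eq : toVRep.toVer = x

/-- Restriction of a representative of a vertical arrow. -/
def Ver.Rep.restrict {X Y : WArrow W} {x : Ver X Y} (p : x.Rep) {D : C} (r : D ⟶ p.T)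
    (h : W (r ≫ p.u₁ ≫ X.hom)) : x.Rep :=
  { cod_eq := p.cod_eq
    u₁ := r ≫ p.u₁
    u₂ := r ≫ p.u₂
    comm := by simp only [Category.assoc, p.comm]
    mem := by simpa only [Category.assoc] using h
    toVer_eq :=
      (Quot.sound ⟨D, 𝟙 D, r, by simp, by simp, by simpa using h⟩ : _ = p.toVRep.toVer).trans
        p.toVer_eq }

theorem Ver.Rep.mk_congr {X Y : WArrow W} {x : Ver X Y} {T : C} {u₁ u₁' : T ⟶ X.dom}
    {u₂ u₂' : T ⟶ Y.dom} (h₁ : u₁ = u₁') (h₂ : u₂ = u₂') (e : X.cod = Y.cod)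
    (c : u₁ ≫ X.hom ≫ eqToHom e = u₂ ≫ Y.hom) (c' : u₁' ≫ X.hom ≫ eqToHom e = u₂' ≫ Y.hom)
    (m : W (u₁ ≫ X.hom)) (m' : W (u₁' ≫ X.hom)) (hx hx') :
    (⟨⟨e, u₁, u₂, c, m⟩, hx⟩ : x.Rep) = ⟨⟨e, u₁', u₂', c', m'⟩, hx'⟩ := by
  subst h₁ h₂
  rfl

theorem Ver.Rep.restrict_restrict {X Y : WArrow W} {x : Ver X Y} (p : x.Rep) {D E : C}
    (r : D ⟶ p.T) (h : W (r ≫ p.u₁ ≫ X.hom)) (s : E ⟶ D) (k) :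
    ∃ k', (p.restrict r h).restrict s k = p.restrict (s ≫ r) k' := by
  have e : (s ≫ r) ≫ p.u₁ ≫ X.hom = s ≫ (r ≫ p.u₁) ≫ X.hom := by simp only [Category.assoc]
  refine ⟨by rw [e]; exact k, ?_⟩
  exact Ver.Rep.mk_congr (Category.assoc _ _ _).symm (Category.assoc _ _ _).symm _ _ _ _ _ _ _

/-- Families of arrows representing the double cells with given frame. For every pair of
representatives `p` and `q` of the two vertical arrows there is a set, possibly empty, of arrows
between their vertices, which make the squares with the horizontal arrows commute. It becomes
nonempty after restriction of `p` along a suitable arrow, and the family is closed under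
restriction. -/
structure CellFamily {X X' Y Y' : WArrow W} (f : X.dom ⟶ X'.dom) (g : Y.dom ⟶ Y'.dom)
    (x : Ver X Y) (y : Ver X' Y') where
  val : ∀ (p : x.Rep) (q : y.Rep), Set (p.T ⟶ q.T)
  comm₁ : ∀ (p : x.Rep) (q : y.Rep), ∀ φ ∈ val p q, p.u₁ ≫ f = φ ≫ q.u₁
  comm₂ : ∀ (p : x.Rep) (q : y.Rep), ∀ φ ∈ val p q, p.u₂ ≫ g = φ ≫ q.u₂
  exists_restrict : ∀ (p : x.Rep) (q : y.Rep), ∃ (D : C) (r : D ⟶ p.T)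
    (h : W (r ≫ p.u₁ ≫ X.hom)), (val (p.restrict r h) q).Nonempty
  restrict_mem : ∀ (p : x.Rep) (q : y.Rep), ∀ φ ∈ val p q, ∀ {D : C} (r : D ⟶ p.T)
    (h : W (r ≫ p.u₁ ≫ X.hom)), r ≫ φ ∈ val (p.restrict r h) q

/-- Two families represent the same double cell when, for every pair of representatives of the two
vertical arrows, they share a value after restriction. -/
def CellFamily.Rel {X X' Y Y' : WArrow W} {f : X.dom ⟶ X'.dom} {g : Y.dom ⟶ Y'.dom}
    {x : Ver X Y} {y : Ver X' Y'} (φ ψ : CellFamily f g x y) : Prop :=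
  ∀ (p : x.Rep) (q : y.Rep), ∃ (D : C) (r : D ⟶ p.T) (h : W (r ≫ p.u₁ ≫ X.hom)),
    (φ.val (p.restrict r h) q ∩ ψ.val (p.restrict r h) q).Nonempty

/-- Double cells: equivalence classes of families. -/
def Cell {X X' Y Y' : WArrow W} (f : X.dom ⟶ X'.dom) (g : Y.dom ⟶ Y'.dom)
    (x : Ver X Y) (y : Ver X' Y') := Quot (CellFamily.Rel (f := f) (g := g) (x := x) (y := y))

theorem CellFamily.mem_restrict_restrict {X X' Y Y' : WArrow W} {f : X.dom ⟶ X'.dom}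
    {g : Y.dom ⟶ Y'.dom} {x : Ver X Y} {y : Ver X' Y'} (φ : CellFamily f g x y) (p : x.Rep)
    (q : y.Rep) {D E : C} (r : D ⟶ p.T) (h : W (r ≫ p.u₁ ≫ X.hom)) (s : E ⟶ D) (k)
    (a : E ⟶ q.T) (ha : φ.val ((p.restrict r h).restrict s k) q a) :
    ∃ k', φ.val (p.restrict (s ≫ r) k') q a := by
  obtain ⟨k', e⟩ := p.restrict_restrict r h s k
  have key : ∀ (p₁ p₂ : x.Rep) (e : p₁ = p₂) (a₁ : p₁.T ⟶ q.T) (a₂ : p₂.T ⟶ q.T),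
      HEq a₁ a₂ → φ.val p₁ q a₁ → φ.val p₂ q a₂ := by
    intro p₁ p₂ e a₁ a₂ h h'
    subst e
    rwa [← eq_of_heq h]
  exact ⟨k', key _ _ e a a HEq.rfl ha⟩

theorem Ver.cod_eq {X Y : WArrow W} (x : Ver X Y) : X.cod = Y.cod := by
  induction x using Quot.inductionOn with
  | h p => exact p.cod_eq

variable [W.HasRightCalculusOfFractions]

theorem VRep.rel {X Y : WArrow W} (p q : VRep X Y) : VRep.Rel p q := by
  obtain @⟨A, B, w, hw⟩ := X
  obtain @⟨A', B', w', hw'⟩ := Y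
  obtain ⟨e, u₁, u₂, hc, hm⟩ := p
  obtain ⟨_, v₁, v₂, hc', hm'⟩ := q
  dsimp only at e u₁ u₂ v₁ v₂ hc hc' hm hm'
  subst e
  simp only [eqToHom_refl, Category.comp_id] at hc hc'
  exact SpanDiagram.rel (W := W)
    (σ := RightFraction.mk w hw w) (τ := RightFraction.mk w' hw' w') ⟨u₁, u₂, hc, hc, hm⟩
    ⟨v₁, v₂, hc', hc', hm'⟩

/-- There is at most one vertical arrow between two objects. -/
theorem Ver.eq {X Y : WArrow W} (x y : Ver X Y) : x = y := by
  induction x using Quot.inductionOn with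
  | h p =>
    induction y using Quot.inductionOn with
    | h q => exact Quot.sound (VRep.rel p q)

theorem Ver.nonempty {X Y : WArrow W} (e : X.cod = Y.cod) : Nonempty (Ver X Y) := by
  obtain @⟨A, B, w, hw⟩ := X
  obtain @⟨A', B', w', hw'⟩ := Y
  dsimp only at e
  subst e
  obtain ⟨r, hr⟩ := (LeftFraction.mk w' w hw).exists_rightFraction
  dsimp only at hr
  refine ⟨Quot.mk _ ⟨rfl, r.f, r.s, by simpa using hr.symm, ?_⟩⟩
  change W (r.f ≫ w)
  rw [← hr]
  exact W.comp_mem _ _ r.hs hw'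

/-- The vertical arrow between two objects with the same codomain. -/
noncomputable def Ver.ofEq {X Y : WArrow W} (e : X.cod = Y.cod) : Ver X Y :=
  (Ver.nonempty e).some

/-- The span defined by a horizontal arrow: its left leg is `X`, and its right leg is the
composite of `f` and `X'`. -/
def toSpan {X X' : WArrow W} (f : X.dom ⟶ X'.dom) : W.RightFraction X.cod X'.cod :=
  RightFraction.mk X.hom X.mem (f ≫ X'.hom)

theorem map_comp_spanMap {X X' : WArrow W} (f : X.dom ⟶ X'.dom) :
    W.Q.map X.hom ≫ spanMap (toSpan f) = W.Q.map f ≫ W.Q.map X'.hom := by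
  rw [toSpan, spanMap_eq, ← Localization.isoOfHom_hom W.Q W X.hom X.mem, Iso.hom_inv_id_assoc,
    Functor.map_comp]

theorem spanMap_toSpan_id (X : WArrow W) : spanMap (toSpan (X := X) (X' := X) (𝟙 X.dom)) = 𝟙 _ := by
  rw [← cancel_epi (Localization.isoOfHom W.Q W X.hom X.mem).hom, Localization.isoOfHom_hom,
    map_comp_spanMap]
  simp

theorem spanMap_toSpan_comp {X X' X'' : WArrow W} (f : X.dom ⟶ X'.dom) (f' : X'.dom ⟶ X''.dom) :
    spanMap (toSpan (X := X) (X' := X'') (f ≫ f')) =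
      spanMap (toSpan f) ≫ spanMap (toSpan f') := by
  rw [← cancel_epi (Localization.isoOfHom W.Q W X.hom X.mem).hom, Localization.isoOfHom_hom,
    map_comp_spanMap, reassoc_of% map_comp_spanMap (X := X) (X' := X') f, map_comp_spanMap]
  simp

/-- Two horizontal arrows define the same arrow of the localization. -/
def SameMap {X X' Y Y' : WArrow W} (f : X.dom ⟶ X'.dom) (g : Y.dom ⟶ Y'.dom) : Prop :=
  ∃ (e : X.cod = Y.cod) (e' : X'.cod = Y'.cod),
    spanMap (toSpan f) ≫ eqToHom (congrArg W.Q.obj e') =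
      eqToHom (congrArg W.Q.obj e) ≫ spanMap (toSpan g)

theorem SameMap.refl {X X' : WArrow W} (f : X.dom ⟶ X'.dom) :
    SameMap (X := X) (X' := X') (Y := X) (Y' := X') f f :=
  ⟨rfl, rfl, by simp⟩

theorem SameMap.id {X Y : WArrow W} (e : X.cod = Y.cod) :
    SameMap (X := X) (X' := X) (Y := Y) (Y' := Y) (𝟙 X.dom) (𝟙 Y.dom) :=
  ⟨e, e, by simp [spanMap_toSpan_id]⟩

theorem SameMap.symm {X X' Y Y' : WArrow W} {f : X.dom ⟶ X'.dom} {g : Y.dom ⟶ Y'.dom}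
    (h : SameMap f g) : SameMap g f := by
  obtain ⟨e, e', h⟩ := h
  refine ⟨e.symm, e'.symm, ?_⟩
  rw [← cancel_mono (eqToHom (congrArg W.Q.obj e')),
    ← cancel_epi (eqToHom (congrArg W.Q.obj e))]
  simp [h]

theorem SameMap.trans {X X' Y Y' Z Z' : WArrow W} {f : X.dom ⟶ X'.dom} {g : Y.dom ⟶ Y'.dom}
    {k : Z.dom ⟶ Z'.dom} (h : SameMap f g) (h' : SameMap g k) : SameMap f k := by
  obtain ⟨e, e', h⟩ := h
  obtain ⟨e₁, e₁', h'⟩ := h'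
  refine ⟨e.trans e₁, e'.trans e₁', ?_⟩
  rw [← eqToHom_trans (congrArg W.Q.obj e') (congrArg W.Q.obj e₁'), reassoc_of% h, h',
    eqToHom_trans_assoc]

theorem SameMap.comp {X X' X'' Y Y' Y'' : WArrow W} {f : X.dom ⟶ X'.dom} {g : Y.dom ⟶ Y'.dom}
    {f' : X'.dom ⟶ X''.dom} {g' : Y'.dom ⟶ Y''.dom} (h : SameMap f g) (h' : SameMap f' g') :
    SameMap (X := X) (X' := X'') (Y := Y) (Y' := Y'') (f ≫ f') (g ≫ g') := by
  obtain ⟨e, e', h⟩ := h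
  obtain ⟨_, e₁', h'⟩ := h'
  refine ⟨e, e₁', ?_⟩
  rw [spanMap_toSpan_comp, spanMap_toSpan_comp, Category.assoc, h', reassoc_of% h]

theorem exists_square {X X' Y Y' : WArrow W} {f : X.dom ⟶ X'.dom} {g : Y.dom ⟶ Y'.dom}
    (h : SameMap f g) (p : VRep X Y) (q : VRep X' Y') :
    ∃ (D : C) (r : D ⟶ p.T) (φ : D ⟶ q.T), W r ∧ (r ≫ p.u₁) ≫ f = φ ≫ q.u₁ ∧
      (r ≫ p.u₂) ≫ g = φ ≫ q.u₂ := by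
  obtain @⟨A, B, w, hw⟩ := X
  obtain @⟨A', B', w', hw'⟩ := X'
  obtain @⟨D, E, z, hz⟩ := Y
  obtain @⟨D', E', z', hz'⟩ := Y'
  obtain ⟨e, e', h⟩ := h
  obtain ⟨_, u₁, u₂, hc, hm⟩ := p
  obtain ⟨_, v₁, v₂, hc', hm'⟩ := q
  dsimp only at f g e e' u₁ u₂ v₁ v₂ hc hc' hm hm' ⊢
  subst e e'
  simp only [eqToHom_refl, Category.comp_id, Category.id_comp] at hc hc' h
  have hL : W.Q.map (u₁ ≫ f ≫ w') = W.Q.map (u₂ ≫ g ≫ z') := by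
    have h1 := map_comp_spanMap (W := W) (X := ⟨w, hw⟩) (X' := ⟨w', hw'⟩) f
    have h2 := map_comp_spanMap (W := W) (X := ⟨z, hz⟩) (X' := ⟨z', hz'⟩) g
    dsimp only at h1 h2
    rw [W.Q.map_comp, W.Q.map_comp, ← h1, W.Q.map_comp, W.Q.map_comp, ← h2, h,
      ← W.Q.map_comp_assoc, ← W.Q.map_comp_assoc, hc]
  obtain ⟨T, t, ht, h3⟩ := (MorphismProperty.map_eq_iff_precomp W.Q W _ _).1 hL
  obtain ⟨ρ, hρ⟩ :=
    (LeftFraction.mk (t ≫ u₁ ≫ f ≫ w') (v₁ ≫ w') hm').exists_rightFraction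
  dsimp only at hρ
  obtain ⟨D₁, t₁, ht₁, h4⟩ := HasRightCalculusOfFractions.ext (W := W)
    (ρ.s ≫ t ≫ u₁ ≫ f) (ρ.f ≫ v₁) w' hw' (by simpa only [Category.assoc] using hρ)
  obtain ⟨D₂, t₂, ht₂, h5⟩ := HasRightCalculusOfFractions.ext (W := W)
    (t₁ ≫ ρ.s ≫ t ≫ u₂ ≫ g) (t₁ ≫ ρ.f ≫ v₂) z' hz' (by
      simp only [Category.assoc] at h3 ⊢
      rw [← h3, hρ, hc'])
  refine ⟨D₂, t₂ ≫ t₁ ≫ ρ.s ≫ t, t₂ ≫ t₁ ≫ ρ.f, ?_, ?_, ?_⟩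
  · exact W.comp_mem _ _ ht₂ (W.comp_mem _ _ ht₁ (W.comp_mem _ _ ρ.hs ht))
  · simp only [Category.assoc] at h4 ⊢
    rw [h4]
  · simpa only [Category.assoc] using h5

/-- The family of all arrows which make the squares commute. -/
def CellFamily.ofSameMap {X X' Y Y' : WArrow W} {f : X.dom ⟶ X'.dom} {g : Y.dom ⟶ Y'.dom}
    (h : SameMap f g) (x : Ver X Y) (y : Ver X' Y') : CellFamily f g x y where
  val p q := { φ | p.u₁ ≫ f = φ ≫ q.u₁ ∧ p.u₂ ≫ g = φ ≫ q.u₂ }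
  comm₁ _ _ _ hφ := hφ.1
  comm₂ _ _ _ hφ := hφ.2
  exists_restrict p q := by
    obtain ⟨D, r, φ, hr, h1, h2⟩ := exists_square h p.toVRep q.toVRep
    exact ⟨D, r, W.comp_mem _ _ hr p.mem, φ, h1, h2⟩
  restrict_mem p q φ hφ _ r _ :=
    ⟨(Category.assoc _ _ _).trans ((congrArg (r ≫ ·) hφ.1).trans (Category.assoc _ _ _).symm),
      (Category.assoc _ _ _).trans ((congrArg (r ≫ ·) hφ.2).trans (Category.assoc _ _ _).symm)⟩

theorem CellFamily.rel {X X' Y Y' : WArrow W} {f : X.dom ⟶ X'.dom} {g : Y.dom ⟶ Y'.dom}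
    {x : Ver X Y} {y : Ver X' Y'} (φ ψ : CellFamily f g x y) : CellFamily.Rel φ ψ := by
  intro p q
  obtain ⟨D, r, h, (a : D ⟶ q.T), ha⟩ := φ.exists_restrict p q
  obtain ⟨E, (s : E ⟶ D), k, (b : E ⟶ q.T), hb⟩ := ψ.exists_restrict (p.restrict r h) q
  obtain ⟨k₁, ha'⟩ := φ.mem_restrict_restrict p q r h s k (s ≫ a)
    (φ.restrict_mem (p.restrict r h) q a ha s k)
  obtain ⟨_, hb'⟩ := ψ.mem_restrict_restrict p q r h s k b hb
  have e : (s ≫ a) ≫ q.u₁ = b ≫ q.u₁ :=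
    (φ.comm₁ _ _ _ ha').symm.trans (ψ.comm₁ _ _ _ hb')
  have e' : (s ≫ a) ≫ (q.u₁ ≫ X'.hom) = b ≫ (q.u₁ ≫ X'.hom) := by
    rw [← Category.assoc, e, Category.assoc]
  obtain ⟨F, t, ht, h6⟩ := HasRightCalculusOfFractions.ext (W := W) _ _ _ q.mem e'
  have k₂ : W (t ≫ (p.restrict (s ≫ r) k₁).u₁ ≫ X.hom) :=
    W.comp_mem _ _ ht (p.restrict (s ≫ r) k₁).mem
  obtain ⟨k₃, h7⟩ := φ.mem_restrict_restrict p q (s ≫ r) k₁ t k₂ (t ≫ s ≫ a)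
    (φ.restrict_mem (p.restrict (s ≫ r) k₁) q (s ≫ a) ha' t k₂)
  obtain ⟨_, h8⟩ := ψ.mem_restrict_restrict p q (s ≫ r) k₁ t k₂ (t ≫ b)
    (ψ.restrict_mem (p.restrict (s ≫ r) k₁) q b hb' t k₂)
  rw [h6] at h7
  exact ⟨F, _, k₃, t ≫ b, h7, h8⟩

/-- There is at most one double cell in every frame. -/
theorem Cell.eq {X X' Y Y' : WArrow W} {f : X.dom ⟶ X'.dom} {g : Y.dom ⟶ Y'.dom}
    {x : Ver X Y} {y : Ver X' Y'} (φ ψ : Cell f g x y) : φ = ψ := by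
  induction φ using Quot.inductionOn with
  | h φ =>
    induction ψ using Quot.inductionOn with
    | h ψ => exact Quot.sound (CellFamily.rel φ ψ)

theorem Cell.heq {X X' Y Y' : WArrow W} {f f' : X.dom ⟶ X'.dom} {g g' : Y.dom ⟶ Y'.dom}
    {x x' : Ver X Y} {y y' : Ver X' Y'} (e : f = f') (e' : g = g') (φ : Cell f g x y)
    (ψ : Cell f' g' x' y') : HEq φ ψ := by
  subst e e'
  obtain rfl := Ver.eq x x'
  obtain rfl := Ver.eq y y'
  exact heq_of_eq (Cell.eq φ ψ)

theorem Cell.sameMap {X X' Y Y' : WArrow W} {f : X.dom ⟶ X'.dom} {g : Y.dom ⟶ Y'.dom}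
    {x : Ver X Y} {y : Ver X' Y'} (φ : Cell f g x y) : SameMap f g := by
  have key : ∀ (p : VRep X Y) (q : VRep X' Y') (a : p.T ⟶ q.T), p.u₁ ≫ f = a ≫ q.u₁ →
      p.u₂ ≫ g = a ≫ q.u₂ → SameMap f g := by
    intro p q a h1 h2
    clear φ x y
    obtain @⟨A, B, w, hw⟩ := X
    obtain @⟨A', B', w', hw'⟩ := X'
    obtain @⟨D, E, z, hz⟩ := Y
    obtain @⟨D', E', z', hz'⟩ := Y'
    obtain ⟨e, u₁, u₂, hc, hm⟩ := p
    obtain ⟨e', v₁, v₂, hc', hm'⟩ := q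
    dsimp only at f g e e' a u₁ u₂ v₁ v₂ hc hc' hm hm' h1 h2
    subst e e'
    simp only [eqToHom_refl, Category.comp_id] at hc hc'
    refine ⟨rfl, rfl, ?_⟩
    simp only [eqToHom_refl, Category.comp_id, Category.id_comp]
    refine SpanCell.nonempty_iff.1 ⟨Quot.mk _ ⟨u₁, u₂, hc, ?_, hm⟩⟩
    change u₁ ≫ f ≫ w' = u₂ ≫ g ≫ z'
    rw [reassoc_of% h1, reassoc_of% h2, hc']
  induction φ using Quot.inductionOn with
  | h φ =>
    obtain ⟨p, hp⟩ := Quot.exists_rep x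
    obtain ⟨q, hq⟩ := Quot.exists_rep y
    obtain ⟨D, r, h, a, ha⟩ := φ.exists_restrict ⟨p, hp⟩ ⟨q, hq⟩
    exact key _ _ a (φ.comm₁ _ _ a ha) (φ.comm₂ _ _ a ha)

/-- The only double cell with a given frame. -/
def Cell.ofSameMap {X X' Y Y' : WArrow W} {f : X.dom ⟶ X'.dom} {g : Y.dom ⟶ Y'.dom}
    (h : SameMap f g) (x : Ver X Y) (y : Ver X' Y') : Cell f g x y :=
  Quot.mk _ (CellFamily.ofSameMap h x y)

end WArrow

/-- The double category `C{W}`: its objects are the arrows in `W`, its horizontal arrows from `X` to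
`Y` are the arrows `X.dom ⟶ Y.dom` of `C`, and its vertical arrows and double cells are equivalence
classes of diagrams and families. There is at most one double cell in every frame, which determines
both compositions of double cells, and at most one vertical arrow between two objects, which
determines their composition. -/
noncomputable def fractionsDbl (W : MorphismProperty C) [W.HasRightCalculusOfFractions] :
    DblCat.{max u v, v, max u v, max u v} where
  Obj := WArrow W
  Hor X Y := X.dom ⟶ Y.dom
  Ver X Y := WArrow.Ver X Y
  Cell f g x y := WArrow.Cell f g x y
  hid X := 𝟙 X.dom
  hcomp f g := f ≫ g
  vid _ := WArrow.Ver.ofEq rfl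
  vcomp x y := WArrow.Ver.ofEq (x.cod_eq.trans y.cod_eq)
  cvid f := WArrow.Cell.ofSameMap (WArrow.SameMap.refl f) _ _
  cvcomp α β := WArrow.Cell.ofSameMap (α.sameMap.trans β.sameMap) _ _
  chid x := WArrow.Cell.ofSameMap (WArrow.SameMap.id x.cod_eq) x x
  chcomp α β := WArrow.Cell.ofSameMap (α.sameMap.comp β.sameMap) _ _
  hid_hcomp f := Category.id_comp f
  hcomp_hid f := Category.comp_id f
  hassoc f g k := Category.assoc f g k
  vid_vcomp _ := WArrow.Ver.eq _ _
  vcomp_vid _ := WArrow.Ver.eq _ _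
  vassoc _ _ _ := WArrow.Ver.eq _ _
  cvid_cvcomp _ := WArrow.Cell.heq rfl rfl _ _
  cvcomp_cvid _ := WArrow.Cell.heq rfl rfl _ _
  cvassoc _ _ _ := WArrow.Cell.heq rfl rfl _ _
  chid_chcomp _ := WArrow.Cell.heq (Category.id_comp _) (Category.id_comp _) _ _
  chcomp_chid _ := WArrow.Cell.heq (Category.comp_id _) (Category.comp_id _) _ _
  chassoc _ _ _ := WArrow.Cell.heq (Category.assoc _ _ _) (Category.assoc _ _ _) _ _
  chcomp_cvid _ _ := WArrow.Cell.eq _ _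
  cvcomp_chid _ _ := WArrow.Cell.eq _ _
  chid_vid _ := WArrow.Cell.eq _ _
  interchange _ _ _ _ := WArrow.Cell.eq _ _

namespace fractionsDbl

variable (W : MorphismProperty C) [W.HasRightCalculusOfFractions]

instance : (fractionsDbl W).FrameThin :=
  ⟨fun _ _ _ _ => ⟨fun φ ψ => WArrow.Cell.eq φ ψ⟩⟩

theorem isWeaklyGlobular : (fractionsDbl W).IsWeaklyGlobular := by
  refine DblCat.IsWeaklyGlobular.of_isofibration (fun _ _ => ⟨fun x y => WArrow.Ver.eq x y⟩)
    (fun _ _ x => WArrow.Ver.ofEq x.cod_eq.symm) ?_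
  rintro ⟨Y, Y', g⟩ X' x'
  have e' : X'.cod = Y'.cod := x'.cod_eq
  clear x'
  have key : ∃ (X : WArrow W) (f : X.dom ⟶ X'.dom), WArrow.SameMap f g := by
    obtain @⟨A', B', w', hw'⟩ := X'
    obtain @⟨D, E, z, hz⟩ := Y
    obtain @⟨D', E', z', hz'⟩ := Y'
    change D ⟶ D' at g
    dsimp only at e'
    subst e'
    obtain ⟨ρ, hρ⟩ := (LeftFraction.mk (g ≫ z') w' hw').exists_rightFraction
    dsimp only at hρ
    refine ⟨⟨ρ.s ≫ z, W.comp_mem _ _ ρ.hs hz⟩, ρ.f, rfl, rfl, ?_⟩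
    simp only [eqToHom_refl, Category.comp_id, Category.id_comp]
    refine SpanCell.nonempty_iff.1 ⟨Quot.mk _ ⟨𝟙 ρ.X', ρ.s, ?_, ?_, ?_⟩⟩
    · exact Category.id_comp _
    · exact (Category.id_comp _).trans hρ.symm
    · exact W.comp_mem _ _ (W.id_mem _) (W.comp_mem _ _ ρ.hs hz)
  obtain ⟨X, f, h⟩ := key
  refine ⟨X, f, ⟨?_⟩⟩
  have e := h.choose
  exact
    { hom := ⟨WArrow.Ver.ofEq e, WArrow.Ver.ofEq e', WArrow.Cell.ofSameMap h _ _⟩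
      inv := ⟨WArrow.Ver.ofEq e.symm, WArrow.Ver.ofEq e'.symm,
        WArrow.Cell.ofSameMap h.symm _ _⟩
      hom_inv_id := DblCat.HArr.Hom.ext (WArrow.Ver.eq _ _) (WArrow.Ver.eq _ _)
        (WArrow.Cell.heq rfl rfl _ _)
      inv_hom_id := DblCat.HArr.Hom.ext (WArrow.Ver.eq _ _) (WArrow.Ver.eq _ _)
        (WArrow.Cell.heq rfl rfl _ _) }

variable {W}

/-- The codomain of the arrows in a path component. -/
def compCod (a : (fractionsDbl W).Comp) : C :=
  Quot.lift (fun X : WArrow W => X.cod)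
    (fun X Y h => by
      change Zigzag (J := (fractionsDbl W).Obj) X Y at h
      induction h with
      | refl => rfl
      | tail _ h ih =>
        rcases h with ⟨⟨y⟩⟩ | ⟨⟨y⟩⟩
        · exact ih.trans (WArrow.Ver.cod_eq y)
        · exact ih.trans (WArrow.Ver.cod_eq y).symm) a

variable (W) in
/-- The choice of the identity arrow in every path component. -/
def idRep : (fractionsDbl W).RepChoice where
  rep a := (⟨𝟙 (compCod a), W.id_mem _⟩ : WArrow W)
  cc_rep a := by
    induction a using Quotient.inductionOn with
    | h X =>
      let y : (fractionsDbl W).Ver (⟨𝟙 X.cod, W.id_mem _⟩ : WArrow W) X := WArrow.Ver.ofEq rfl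
      exact DblCat.cc_eq_of_ver y

end fractionsDbl

end FractionsDoubleCategory
section Comparison

open MorphismProperty

variable {C : Type u} [Category.{v} C] {W : MorphismProperty C}

theorem comp_eqToHom_mem {A B B' : C} (s : A ⟶ B) (hs : W s) (e : B = B') :
    W (s ≫ eqToHom e) := by
  subst e
  simpa using hs

variable [W.HasRightCalculusOfFractions]

variable (W) in
/-- The fundamental bicategory of `C{W}`, with the units given by the identity arrows in the
components, and composition by means of a choice `M` of strictly composable replacements. -/
abbrev BicFractions (M : (fractionsDbl W).SegalChoice) :=
  DblCat.Bic (fractionsDbl.isWeaklyGlobular W) (fractionsDbl.idRep W) M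

/-- The assignment `ω`: the component of `w : A ⟶ B` goes to `B`, and the arrow
`B ⟵ A ⟶ A' ⟶ B'` given by `w`, `f`, `w'` goes to the span with legs `w` and `f ≫ w'`. -/
noncomputable def omegaMap (M : (fractionsDbl W).SegalChoice) (S : ChosenSquares W) :
    Prefunctor (BicFractions W M) (Frac S) where
  obj a := ⟨fractionsDbl.compCod a.comp⟩
  map {_ _} f :=
    let X : WArrow W := f.arr.src
    let X' : WArrow W := f.arr.tgt
    let k : X.dom ⟶ X'.dom := f.arr.arr
    RightFraction.mk (X.hom ≫ eqToHom (congrArg fractionsDbl.compCod f.src_eq))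
      (comp_eqToHom_mem X.hom X.mem _)
      (k ≫ X'.hom ≫ eqToHom (congrArg fractionsDbl.compCod f.tgt_eq))

/-- The assignment `α`: the object `A` goes to the component of its identity, and the span with
legs `w` and `f` goes to the horizontal arrow `f` from `w` to the identity of the codomain of `f`. -/
noncomputable def alphaMap (M : (fractionsDbl W).SegalChoice) (S : ChosenSquares W) :
    Prefunctor (Frac S) (BicFractions W M) where
  obj A := ⟨DblCat.cc (X := fractionsDbl W) (⟨𝟙 A.as, W.id_mem _⟩ : WArrow W)⟩
  map {A B} σ :=
    { arr :=
        { src := (⟨RightFraction.s σ, RightFraction.hs σ⟩ : WArrow W)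
          tgt := (⟨𝟙 B.as, W.id_mem _⟩ : WArrow W)
          arr := RightFraction.f σ }
      src_eq :=
        let y : (fractionsDbl W).Ver (⟨RightFraction.s σ, RightFraction.hs σ⟩ : WArrow W)
          (⟨𝟙 A.as, W.id_mem _⟩ : WArrow W) := WArrow.Ver.ofEq rfl
        DblCat.cc_eq_of_ver y
      tgt_eq := rfl }

end Comparison
section MarkedPaths

open Bicategory

universe w₁ v₁ u₁

variable (B : Type u₁) [Bicategory.{w₁, v₁} B]

variable {B} in
/-- The composites of a path of arrows: all arrows obtained by bracketing it, where units may be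
inserted. -/
inductive IsComposite : ∀ {a b : B}, Quiver.Path a b → (a ⟶ b) → Prop
  | nil (a : B) : IsComposite (Quiver.Path.nil : Quiver.Path a a) (𝟙 a)
  | single {a b : B} (f : a ⟶ b) : IsComposite f.toPath f
  | comp {a b c : B} {p : Quiver.Path a b} {q : Quiver.Path b c} {f : a ⟶ b} {g : b ⟶ c} :
      IsComposite p f → IsComposite q g → IsComposite (p.comp q) (f ≫ g)

/-- A choice of a composite for every finite path of arrows, which is the identity for empty
paths. -/
structure PathComposites where
  φ : ∀ {a b : B}, Quiver.Path a b → (a ⟶ b)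
  isComposite : ∀ {a b : B} (p : Quiver.Path a b), IsComposite p (φ p)
  φ_nil : ∀ a : B, φ (Quiver.Path.nil : Quiver.Path a a) = 𝟙 a

variable {B}

/-- The composite of a path bracketed from the left. -/
def leftComposite {a : B} : ∀ {b : B}, Quiver.Path a b → (a ⟶ b)
  | _, .nil => 𝟙 a
  | _, .cons p f => leftComposite p ≫ f

theorem nonempty_leftComposite_comp {a b c : B} (p : Quiver.Path a b) (q : Quiver.Path b c) :
    Nonempty (leftComposite (p.comp q) ≅ leftComposite p ≫ leftComposite q) := by
  induction q with
  | nil => exact ⟨(ρ_ _).symm⟩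
  | cons q f ih =>
    obtain ⟨i⟩ := ih
    exact ⟨whiskerRightIso i f ≪≫ α_ _ _ _⟩

theorem IsComposite.nonempty_iso {a b : B} {p : Quiver.Path a b} {f : a ⟶ b}
    (h : IsComposite p f) : Nonempty (f ≅ leftComposite p) := by
  induction h with
  | nil a => exact ⟨Iso.refl _⟩
  | single f => exact ⟨(λ_ f).symm⟩
  | @comp a b c p q f g _ _ ih ih' =>
    obtain ⟨i⟩ := ih
    obtain ⟨j⟩ := ih'
    obtain ⟨k⟩ := nonempty_leftComposite_comp p q
    exact ⟨whiskerRightIso i g ≪≫ whiskerLeftIso (leftComposite p) j ≪≫ k.symm⟩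

theorem nonempty_pathComposites : Nonempty (PathComposites B) := by
  have h : ∀ {a b : B} (p : Quiver.Path a b), IsComposite p (leftComposite p) := by
    intro a b p
    induction p with
    | nil => exact IsComposite.nil a
    | cons p f ih => exact IsComposite.comp ih (IsComposite.single f)
  exact ⟨⟨leftComposite, h, fun _ => rfl⟩⟩

namespace PathComposites

variable (Φ : PathComposites B)

theorem nonempty_comparison {a b c : B} (p : Quiver.Path a b) (q : Quiver.Path b c) :
    Nonempty (Φ.φ (p.comp q) ≅ Φ.φ p ≫ Φ.φ q) := by
  obtain ⟨i⟩ := (Φ.isComposite p).nonempty_iso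
  obtain ⟨j⟩ := (Φ.isComposite q).nonempty_iso
  obtain ⟨k⟩ := (Φ.isComposite (p.comp q)).nonempty_iso
  obtain ⟨l⟩ := nonempty_leftComposite_comp p q
  exact ⟨k ≪≫ l ≪≫ whiskerRightIso i.symm _ ≪≫ whiskerLeftIso (Φ.φ p) j.symm⟩

/-- The comparison 2-cell between composites of paths; in a locally posetal bicategory, it is the
only one. -/
noncomputable def comparison {a b c : B} (p : Quiver.Path a b) (q : Quiver.Path b c) :
    Φ.φ (p.comp q) ≅ Φ.φ p ≫ Φ.φ q := (Φ.nonempty_comparison p q).some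

/-- Horizontal pasting of 2-cells between chosen composites. -/
noncomputable def hpaste {a b c a' b' c' : B} (e : a = a') (e' : b = b') (e'' : c = c')
    {p : Quiver.Path a b} {q : Quiver.Path b c} {p' : Quiver.Path a' b'} {q' : Quiver.Path b' c'}
    (α : castHom e e' (Φ.φ p) ⟶ Φ.φ p') (β : castHom e' e'' (Φ.φ q) ⟶ Φ.φ q') :
    castHom e e'' (Φ.φ (p.comp q)) ⟶ Φ.φ (p'.comp q') :=
  match a', b', c', e, e', e'', p', q', α, β with
  | _, _, _, rfl, rfl, rfl, p', q', α, β =>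
    (Φ.comparison p q).hom ≫ (α ▷ Φ.φ q) ≫ (Φ.φ p' ◁ β) ≫ (Φ.comparison p' q').inv

end PathComposites

theorem castHom_castHom {a b a' b' a'' b'' : B} (e : a = a') (e₁ : b = b') (e' : a' = a'')
    (e₁' : b' = b'') (f : a ⟶ b) :
    castHom (e.trans e') (e₁.trans e₁') f = castHom e' e₁' (castHom e e₁ f) := by
  subst e e₁ e' e₁'
  rfl

variable (B) in
/-- A finite path in `B` with a marked object on it; `before` and `after` are the parts of the path
up to and from the marked object. -/
structure MarkedPath where
  {fst mark lst : B}
  before : Quiver.Path fst mark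
  after : Quiver.Path mark lst

namespace MarkedPath

/-- A horizontal arrow: two marked objects, in this order, on the same path. The part of the path
between them is `between`. -/
@[ext]
structure Hor (X Y : MarkedPath B) where
  fst_eq : X.fst = Y.fst
  lst_eq : X.lst = Y.lst
  between : Quiver.Path X.mark Y.mark
  before_eq : (X.before.cast fst_eq rfl).comp between = Y.before
  after_eq : between.comp (Y.after.cast rfl lst_eq.symm) = X.after

theorem Hor.eq {X Y : MarkedPath B} (f g : Hor X Y) : f = g := by
  apply Hor.ext
  exact Quiver.Path.comp_injective_right _ (f.before_eq.trans g.before_eq.symm)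

/-- The horizontal identity. -/
def Hor.id (X : MarkedPath B) : Hor X X where
  fst_eq := rfl
  lst_eq := rfl
  between := Quiver.Path.nil
  before_eq := rfl
  after_eq := Quiver.Path.nil_comp _

/-- Horizontal composition. -/
def Hor.comp {X Y Z : MarkedPath B} (f : Hor X Y) (g : Hor Y Z) : Hor X Z where
  fst_eq := f.fst_eq.trans g.fst_eq
  lst_eq := f.lst_eq.trans g.lst_eq
  between := f.between.comp g.between
  before_eq := by
    obtain @⟨a, b, c, p, q⟩ := X
    obtain @⟨a', b', c', p', q'⟩ := Y
    obtain @⟨a'', b'', c'', p'', q''⟩ := Z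
    obtain ⟨e, e', m, h, h'⟩ := f
    obtain ⟨e₁, e₁', m₁, h₁, h₁'⟩ := g
    dsimp only at e e' m h h' e₁ e₁' m₁ h₁ h₁'
    subst e e' e₁ e₁' h h₁
    exact (Quiver.Path.comp_assoc _ _ _).symm
  after_eq := by
    obtain @⟨a, b, c, p, q⟩ := X
    obtain @⟨a', b', c', p', q'⟩ := Y
    obtain @⟨a'', b'', c'', p'', q''⟩ := Z
    obtain ⟨e, e', m, h, h'⟩ := f
    obtain ⟨e₁, e₁', m₁, h₁, h₁'⟩ := g
    dsimp only at e e' m h h' e₁ e₁' m₁ h₁ h₁'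
    subst e e' e₁ e₁'
    exact (Quiver.Path.comp_assoc _ _ _).trans ((congrArg m.comp h₁').trans h')

end MarkedPath

variable [∀ a b : B, Quiver.IsThin (a ⟶ b)]

theorem cell_heq {a b a' b' : B} {f f₁ : a ⟶ b} {g g₁ : a' ⟶ b'} (e : a = a')
    (e' : b = b') (hf : f = f₁) (hg : g = g₁) (α : castHom e e' f ⟶ g)
    (β : castHom e e' f₁ ⟶ g₁) : HEq α β := by
  subst hf hg
  exact heq_of_eq (Subsingleton.elim _ _)

/-- The double category `Dbl(B)` of marked paths in a (locally posetal) bicategory `B`. There is a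
unique vertical arrow between any two objects with the same marked object. The double cells are the
2-cells between the chosen composites of the parts between the two marks. -/
noncomputable def markedPathsDbl (Φ : PathComposites B) : DblCat.{max u₁ v₁, max u₁ v₁, 0, w₁} where
  Obj := MarkedPath B
  Hor X Y := MarkedPath.Hor X Y
  Ver X Y := PLift (X.mark = Y.mark)
  Cell f g x y := castHom x.down y.down (Φ.φ f.between) ⟶ Φ.φ g.between
  hid X := MarkedPath.Hor.id X
  hcomp f g := MarkedPath.Hor.comp f g
  vid _ := ⟨rfl⟩
  vcomp x y := ⟨x.down.trans y.down⟩
  cvid f := 𝟙 (Φ.φ f.between)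
  cvcomp {_ _ _ _ _ _ _ _ _ x y x' y'} α β :=
    eqToHom (castHom_castHom x.down y.down x'.down y'.down _) ≫ castHom₂ x'.down y'.down α ≫ β
  chid {X Y} x := eqToHom (by
    change castHom x.down x.down (Φ.φ Quiver.Path.nil) = Φ.φ Quiver.Path.nil
    rw [Φ.φ_nil, Φ.φ_nil, castHom_id])
  chcomp α β := Φ.hpaste _ _ _ α β
  hid_hcomp _ := MarkedPath.Hor.eq _ _
  hcomp_hid _ := MarkedPath.Hor.eq _ _
  hassoc _ _ _ := MarkedPath.Hor.eq _ _
  vid_vcomp _ := rfl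
  vcomp_vid _ := rfl
  vassoc _ _ _ := rfl
  cvid_cvcomp _ := cell_heq _ _ rfl rfl _ _
  cvcomp_cvid _ := cell_heq _ _ rfl rfl _ _
  cvassoc _ _ _ := cell_heq _ _ rfl rfl _ _
  chid_chcomp _ := cell_heq _ _ (congrArg Φ.φ (Quiver.Path.nil_comp _))
    (congrArg Φ.φ (Quiver.Path.nil_comp _)) _ _
  chcomp_chid _ := cell_heq _ _ rfl rfl _ _
  chassoc _ _ _ := cell_heq _ _ (congrArg Φ.φ (Quiver.Path.comp_assoc _ _ _))
    (congrArg Φ.φ (Quiver.Path.comp_assoc _ _ _)) _ _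
  chcomp_cvid _ _ := Subsingleton.elim _ _
  cvcomp_chid _ _ := Subsingleton.elim _ _
  chid_vid _ := Subsingleton.elim _ _
  interchange _ _ _ _ := Subsingleton.elim _ _

end MarkedPaths

section PseudoEquivalence

open Bicategory

open scoped CategoryTheory.Pseudofunctor.StrongTrans

/-- Equivalence of two simplicial categories in the bicategory of pseudofunctors, pseudonatural
transformations and modifications. For horizontal nerves of weakly globular double categories this
is equivalence with respect to pseudo-functors and vertical transformations. -/
def PsEquivalent (P Q : Pseudofunctor (LocallyDiscrete SimplexCategoryᵒᵖ) Cat.{w, u}) : Prop :=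
  Nonempty (P ≌ Q)

end PseudoEquivalence

/-!
The localization `C[W⁻¹]` as an ordinary category controls everything. Since `W` admits a calculus of
right fractions, every arrow of `C[W⁻¹]` is a fraction, represented by a span, and two spans are
connected by a (necessarily unique) 2-cell exactly when they represent the same fraction. In the
same way a horizontal arrow `f : w ⟶ w'` of `C{W}` represents the fraction `w' ∘ f ∘ w⁻¹`, there is
a vertical arrow between two objects exactly when they have the same codomain, and a double cell
in a frame exactly when top and bottom represent the same fraction.

The comparison of `Bic(C{W})` and `C(W⁻¹)` follows: both are locally posetal with invertible 2-cells,
and `nonempty_bicHom_iff` and `toLoc_omegaMap_comp` say that `ω` preserves and reflects the existence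
of 2-cells and is compatible with composition of fractions. The coherence conditions of normal
homomorphisms and icons are equations between parallel 2-cells, hence automatic
(`exists_strictlyUnitaryPseudofunctor`, `exists_icon`).

For the double categories, the situation is described by a `DblCat.Realization`: a functor from the
horizontal category of `X` to a category `L` such that vertical arrows and double cells amount to
equalities in `L`. If, moreover, all chains of arrows of `L` lift to `X`, then the category at level
`n` of the horizontal nerve is a thin groupoid whose isomorphism classes are the functors `[n] ⥤ L`.
This makes `X` weakly globular (`LiftsChains.isWeaklyGlobular`), and it determines the nerve of `X`
up to pseudonatural equivalence by the simplicial set of chains in `L`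
(`ClassifiedBy.nonempty_equivalence`). Both `C{W}` and `Dbl(C(W⁻¹))` have such a realization in
`C[W⁻¹]`: for `C{W}` chains are lifted by means of the Segal maps, and for marked paths a chain of
spans is a single path with all its objects marked.
-/

/-! ### Pseudofunctors with values in setoids -/

section Classification

open Bicategory

open scoped CategoryTheory.Pseudofunctor.StrongTrans

universe u₀ v₀ w₀ t

variable {A : Type u₀} [Bicategory.{w₀, v₀} A]

theorem cat_hom₂_eq {D E : Cat.{w, u}} (hE : ∀ x y : E, Subsingleton (x ⟶ y)) {F G : D ⟶ E}
    (η θ : F ⟶ G) : η = θ := by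
  apply Cat.Hom₂.ext
  ext x
  exact (hE _ _).elim _ _

/-- A classification of the objects of the categories `P a` up to isomorphism: each `P a` is a
thin groupoid whose isomorphism classes are the elements of `T a`, compatibly with the transition
maps `t` of `T`. -/
structure ClassifiedBy (P : Pseudofunctor A Cat.{w, u}) (T : A → Type t)
    (t : ∀ {a b : A}, (a ⟶ b) → T a → T b) where
  cls : ∀ {a : A}, P.obj a → T a
  subsingleton_hom : ∀ {a : A} (x y : P.obj a), Subsingleton (x ⟶ y)
  nonempty_hom_iff : ∀ {a : A} (x y : P.obj a), Nonempty (x ⟶ y) ↔ cls x = cls y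
  surjective : ∀ a : A, Function.Surjective (cls (a := a))
  cls_map : ∀ {a b : A} (f : a ⟶ b) (x : P.obj a), cls ((P.map f).toFunctor.obj x) = t f (cls x)

namespace ClassifiedBy

variable {P Q : Pseudofunctor A Cat.{w, u}} {T : A → Type t}
  {t : ∀ {a b : A}, (a ⟶ b) → T a → T b}

/-- The only arrow between two objects of the same class. -/
noncomputable def homOfEq (p : ClassifiedBy P T t) {a : A} {x y : P.obj a}
    (e : p.cls x = p.cls y) : x ⟶ y :=
  ((p.nonempty_hom_iff x y).2 e).some

/-- Two functors into `P a` which agree on classes are isomorphic. -/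
noncomputable def isoOfEq (p : ClassifiedBy P T t) {D : Cat.{w, u}} {a : A} {F G : D ⟶ P.obj a}
    (e : ∀ x : D, p.cls (F.toFunctor.obj x) = p.cls (G.toFunctor.obj x)) : F ≅ G where
  hom := ⟨{ app := fun x => p.homOfEq (e x)
            naturality := fun _ _ _ => (p.subsingleton_hom _ _).elim _ _ }⟩
  inv := ⟨{ app := fun x => p.homOfEq (e x).symm
            naturality := fun _ _ _ => (p.subsingleton_hom _ _).elim _ _ }⟩
  hom_inv_id := cat_hom₂_eq p.subsingleton_hom _ _
  inv_hom_id := cat_hom₂_eq p.subsingleton_hom _ _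

/-- The functor `P a ⥤ Q a` sending an object to a chosen object of the same class. -/
noncomputable def transferApp (p : ClassifiedBy P T t) (q : ClassifiedBy Q T t) (a : A) :
    P.obj a ⟶ Q.obj a where
  toFunctor :=
    { obj := fun x => (q.surjective a (p.cls x)).choose
      map := fun {x y} f => q.homOfEq (by
        rw [(q.surjective a (p.cls x)).choose_spec, (q.surjective a (p.cls y)).choose_spec]
        exact (p.nonempty_hom_iff x y).1 ⟨f⟩)
      map_id := fun _ => (q.subsingleton_hom _ _).elim _ _
      map_comp := fun _ _ => (q.subsingleton_hom _ _).elim _ _ }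

theorem cls_transferApp (p : ClassifiedBy P T t) (q : ClassifiedBy Q T t) {a : A} (x : P.obj a) :
    q.cls ((transferApp p q a).toFunctor.obj x) = p.cls x :=
  (q.surjective a (p.cls x)).choose_spec

/-- The pseudonatural transformation between two pseudofunctors with the same classification. All
coherence conditions are equations between arrows of thin categories. -/
noncomputable def transfer (p : ClassifiedBy P T t) (q : ClassifiedBy Q T t) : P ⟶ Q where
  app a := transferApp p q a
  naturality f := q.isoOfEq (fun x => by
    rw [Cat.Hom.comp_obj, Cat.Hom.comp_obj, cls_transferApp, p.cls_map, q.cls_map,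
      cls_transferApp])
  naturality_naturality _ := cat_hom₂_eq q.subsingleton_hom _ _
  naturality_id _ := cat_hom₂_eq q.subsingleton_hom _ _
  naturality_comp _ _ := cat_hom₂_eq q.subsingleton_hom _ _

/-- Two pseudonatural transformations into `Q` which agree on classes are isomorphic. -/
noncomputable def transIso (q : ClassifiedBy Q T t) {η θ : P ⟶ Q}
    (e : ∀ (a : A) (x : P.obj a),
      q.cls ((η.app a).toFunctor.obj x) = q.cls ((θ.app a).toFunctor.obj x)) : η ≅ θ :=
  Pseudofunctor.StrongTrans.isoMk (fun a => q.isoOfEq (e a))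
    (fun _ => cat_hom₂_eq q.subsingleton_hom _ _)

/-- Pseudofunctors with the same classification are equivalent. -/
theorem nonempty_equivalence (p : ClassifiedBy P T t) (q : ClassifiedBy Q T t) :
    Nonempty (P ≌ Q) := by
  refine ⟨Equivalence.mkOfAdjointifyCounit (f := transfer p q) (g := transfer q p)
    (p.transIso fun a x => ?_) (q.transIso fun a x => ?_)⟩
  · change p.cls x = p.cls ((transferApp q p a).toFunctor.obj ((transferApp p q a).toFunctor.obj x))
    rw [cls_transferApp, cls_transferApp]
  · change q.cls ((transferApp p q a).toFunctor.obj ((transferApp q p a).toFunctor.obj x)) = q.cls x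
    rw [cls_transferApp, cls_transferApp]

end ClassifiedBy

end Classification

/-! ### Double categories over a category -/

theorem finFunctor_ext {L : Type u} [Category.{w} L] {n : ℕ} {F G : Fin (n + 1) ⥤ L}
    (e : ∀ k, F.obj k = G.obj k)
    (e' : ∀ k : Fin n, HEq (F.map (homOfLE k.castSucc_le_succ))
      (G.map (homOfLE k.castSucc_le_succ))) : F = G :=
  ComposableArrows.ext e fun i hi =>
    (conj_eqToHom_iff_heq _ _ (e _) (e _)).2 (e' ⟨i, hi⟩)

theorem exists_finFunctor {L : Type u} [Category.{w} L] {n : ℕ} (b : Fin (n + 1) → L)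
    (q : ∀ k : Fin n, b k.castSucc ⟶ b k.succ) :
    ∃ G : Fin (n + 1) ⥤ L, (∀ k, G.obj k = b k) ∧
      ∀ k : Fin n, HEq (G.map (homOfLE k.castSucc_le_succ)) (q k) :=
  ⟨ComposableArrows.mkOfObjOfMapSucc b q, fun _ => rfl, fun k =>
    heq_of_eq (ComposableArrows.mkOfObjOfMapSucc_map_succ b q k.val k.isLt)⟩

namespace DblCat

variable (X : DblCat.{o, h, v, c}) (L : Type u) [Category.{w} L]

/-- A functor from the objects and horizontal arrows of `X` to a category `L` which determines the
vertical arrows and the double cells of `X`: there is exactly one vertical arrow between two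
objects with the same image, exactly one double cell in a frame whose top and bottom have the same
image, and there are no others. -/
structure Realization where
  obj : X.Obj → L
  map : ∀ {a b : X.Obj}, X.Hor a b → (obj a ⟶ obj b)
  map_hid : ∀ a : X.Obj, map (X.hid a) = 𝟙 (obj a)
  map_hcomp : ∀ {a b d : X.Obj} (f : X.Hor a b) (g : X.Hor b d),
    map (X.hcomp f g) = map f ≫ map g
  subsingleton_ver : ∀ a b : X.Obj, Subsingleton (X.Ver a b)
  frameThin : X.FrameThin
  nonempty_ver_iff : ∀ a b : X.Obj, Nonempty (X.Ver a b) ↔ obj a = obj b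
  nonempty_cell_iff : ∀ {a b a' b' : X.Obj} (f : X.Hor a b) (g : X.Hor a' b') (x : X.Ver a a')
    (y : X.Ver b b'), Nonempty (X.Cell f g x y) ↔ HEq (map f) (map g)

namespace Realization

variable {X L} (R : X.Realization L)

/-- The image of a horizontal diagram. -/
def functor {J : Type*} [Category J] (F : Diag X J) : J ⥤ L where
  obj i := R.obj (F.obj i)
  map s := R.map (F.map s)
  map_id i := by rw [F.map_id, R.map_hid]
  map_comp s s' := by rw [F.map_comp, R.map_hcomp]

theorem subsingleton_hom (R : X.Realization L) {J : Type*} [Category J] (F G : Diag X J) :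
    Subsingleton (F ⟶ G) := by
  have := R.frameThin
  refine ⟨fun α β => ?_⟩
  obtain ⟨a, ac, _, _⟩ := α
  obtain ⟨b, bc, _, _⟩ := β
  obtain rfl : a = b := funext fun i => (R.subsingleton_ver _ _).elim _ _
  exact Diag.Hom.ext_heq (fun _ => rfl) (fun s => FrameThin.heq rfl rfl _ _)

theorem nonempty_hom_iff {J : Type*} [Category J] (F G : Diag X J) :
    Nonempty (F ⟶ G) ↔ R.functor F = R.functor G := by
  have := R.frameThin
  constructor
  · rintro ⟨α⟩
    exact Functor.hext (fun i => (R.nonempty_ver_iff _ _).1 ⟨α.app i⟩)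
      (fun i j s => (R.nonempty_cell_iff _ _ _ _).1 ⟨α.cell s⟩)
  · intro e
    have app : ∀ i, X.Ver (F.obj i) (G.obj i) := fun i =>
      ((R.nonempty_ver_iff _ _).2 (congrArg (fun K => K.obj i) e)).some
    have cell : ∀ {i j : J} (s : i ⟶ j), X.Cell (F.map s) (G.map s) (app i) (app j) := fun s =>
      ((R.nonempty_cell_iff _ _ _ _).2 (congr_arg_heq (fun K => K.map s) e)).some
    exact ⟨⟨app, cell, fun i => FrameThin.heq (F.map_id i) (G.map_id i) _ _,
      fun s s' => FrameThin.heq (F.map_comp s s') (G.map_comp s s') _ _⟩⟩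

theorem harrHom_eq (R : X.Realization L) {f g : X.HArr} (α β : f ⟶ g) : α = β := by
  have := R.frameThin
  obtain ⟨l, r, s⟩ := α
  obtain ⟨l', r', s'⟩ := β
  obtain rfl := (R.subsingleton_ver _ _).elim l l'
  obtain rfl := (R.subsingleton_ver _ _).elim r r'
  obtain rfl := eq_of_heq (FrameThin.heq rfl rfl s s')
  rfl

theorem nonempty_harrHom_iff (f g : X.HArr) : Nonempty (f ⟶ g) ↔
    R.obj f.src = R.obj g.src ∧ R.obj f.tgt = R.obj g.tgt ∧ HEq (R.map f.arr) (R.map g.arr) := by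
  constructor
  · rintro ⟨α⟩
    exact ⟨(R.nonempty_ver_iff _ _).1 ⟨α.left⟩, (R.nonempty_ver_iff _ _).1 ⟨α.right⟩,
      (R.nonempty_cell_iff _ _ _ _).1 ⟨α.cell⟩⟩
  · rintro ⟨e, e', e''⟩
    obtain ⟨x⟩ := (R.nonempty_ver_iff _ _).2 e
    obtain ⟨y⟩ := (R.nonempty_ver_iff _ _).2 e'
    exact ⟨⟨x, y, ((R.nonempty_cell_iff _ _ x y).2 e'').some⟩⟩

theorem nonempty_harrIso_iff (f g : X.HArr) : Nonempty (f ≅ g) ↔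
    R.obj f.src = R.obj g.src ∧ R.obj f.tgt = R.obj g.tgt ∧ HEq (R.map f.arr) (R.map g.arr) := by
  constructor
  · rintro ⟨i⟩
    exact (R.nonempty_harrHom_iff f g).1 ⟨i.hom⟩
  · rintro ⟨e, e', e''⟩
    exact ⟨⟨((R.nonempty_harrHom_iff f g).2 ⟨e, e', e''⟩).some,
      ((R.nonempty_harrHom_iff g f).2 ⟨e.symm, e'.symm, e''.symm⟩).some,
      R.harrHom_eq _ _, R.harrHom_eq _ _⟩⟩

theorem cc_eq_iff {a b : X.Obj} : cc a = cc b ↔ R.obj a = R.obj b := by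
  constructor
  · intro e
    have z : Zigzag a b := Quotient.exact e
    induction z with
    | refl => rfl
    | tail _ s ih =>
      rcases s with ⟨⟨y⟩⟩ | ⟨⟨y⟩⟩
      · exact (ih (Quotient.sound (by assumption))).trans ((R.nonempty_ver_iff _ _).1 ⟨y⟩)
      · exact (ih (Quotient.sound (by assumption))).trans ((R.nonempty_ver_iff _ _).1 ⟨y⟩).symm
  · intro e
    exact cc_eq_of_ver ((R.nonempty_ver_iff _ _).2 e).some

/-- All chains of arrows of `L` are images of chains of horizontal arrows. -/
def LiftsChains : Prop :=
  ∀ (n : ℕ) (G : Fin (n + 1) ⥤ L), ∃ F : Diag X (Fin (n + 1)), R.functor F = G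

/-- A chain of arrows of `L` lifts to a diagram once its objects and its consecutive arrows lift to
matching objects and horizontal arrows. -/
theorem exists_functor_eq {n : ℕ} {G : Fin (n + 1) ⥤ L} (p : Fin (n + 1) → X.Obj)
    (m : ∀ k : Fin n, X.Hor (p k.castSucc) (p k.succ)) (hp : ∀ k, R.obj (p k) = G.obj k)
    (hm : ∀ k : Fin n, HEq (R.map (m k)) (G.map (homOfLE k.castSucc_le_succ))) :
    ∃ F : Diag X (Fin (n + 1)), R.functor F = G := by
  let cat : Category X.Obj :=
    { Hom := X.Hor, id := X.hid, comp := X.hcomp, id_comp := X.hid_hcomp, comp_id := X.hcomp_hid,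
      assoc := X.hassoc }
  let E := @ComposableArrows.mkOfObjOfMapSucc X.Obj cat n p m
  refine ⟨⟨E.obj, E.map, E.map_id, E.map_comp⟩, finFunctor_ext hp fun k => ?_⟩
  have e : E.map (homOfLE k.castSucc_le_succ) = m k :=
    @ComposableArrows.mkOfObjOfMapSucc_map_succ X.Obj cat n p m k.val k.isLt
  exact (heq_of_eq (congrArg R.map e)).trans (hm k)

/-- In the presence of lifts of chains, `X₁ ×_{X₀} ⋯ ×_{X₀} X₁` and `X₁ ×_{X₀ᵈ} ⋯ ×_{X₀ᵈ} X₁` are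
both equivalent to the discrete category of chains in `L`. -/
theorem LiftsChains.isWeaklyGlobular {R : X.Realization L} (hR : R.LiftsChains) :
    X.IsWeaklyGlobular := by
  refine ⟨?_, fun n hn => ?_⟩
  · refine { faithful := ⟨fun _ => (R.subsingleton_ver _ _).elim _ _⟩,
             full := ⟨fun {a b} f => ?_⟩, essSurj := ⟨fun d => ?_⟩ }
    · obtain ⟨x⟩ := (R.nonempty_ver_iff a b).2
        (R.cc_eq_iff.1 (congrArg id (Discrete.eq_of_hom f)))
      exact ⟨x, Subsingleton.elim _ _⟩
    · obtain ⟨d⟩ := d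
      induction d using Quotient.inductionOn with
      | h a => exact ⟨a, ⟨Iso.refl _⟩⟩
  · obtain ⟨m, rfl⟩ : ∃ m, n = m + 1 := ⟨n - 1, by omega⟩
    refine { faithful := ⟨fun {F G} _ _ _ => (R.subsingleton_hom F G).elim _ _⟩,
             full := ⟨fun {F G} φ => ?_⟩, essSurj := ⟨fun d => ?_⟩ }
    · have key := fun k => (R.nonempty_harrHom_iff _ _).1 ⟨φ.hom k⟩
      obtain ⟨α⟩ := (R.nonempty_hom_iff F G).2 (finFunctor_ext
        (fun i => Fin.lastCases (key (Fin.last m)).2.1 (fun k => (key k).1) i)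
        (fun k => (key k).2.2))
      refine ⟨α, ?_⟩
      apply ObjectProperty.hom_ext
      funext k
      exact R.harrHom_eq _ _
    · have hd : ∀ k : Fin m, R.obj (d.obj k.castSucc).tgt = R.obj (d.obj k.succ).src :=
        fun k => R.cc_eq_iff.1 (d.property k.castSucc k.succ rfl)
      let b : Fin (m + 2) → L :=
        Fin.cons (R.obj (d.obj 0).src) (fun k => R.obj (d.obj k).tgt)
      have hb : ∀ k : Fin (m + 1), b k.castSucc = R.obj (d.obj k).src := by
        intro k
        induction k using Fin.cases with
        | zero => rfl
        | succ k => exact hd k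
      obtain ⟨G, hG, hG'⟩ := exists_finFunctor b
        (fun k => eqToHom (hb k) ≫ R.map (d.obj k).arr)
      obtain ⟨F, rfl⟩ := hR _ G
      refine ⟨F, ⟨ObjectProperty.isoMk _ (Pi.isoMk fun k => ?_)⟩⟩
      exact ((R.nonempty_harrIso_iff
        ⟨F.obj k.castSucc, F.obj k.succ, F.map (homOfLE k.castSucc_le_succ)⟩ (d.obj k)).2
        ⟨(hG k.castSucc).trans (hb k), hG k.succ,
          (hG' k).trans (eqToHom_comp_heq _ _)⟩).some

/-- The chains in `L` classify the objects of the horizontal nerve. -/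
def LiftsChains.classifiedBy {R : X.Realization L} (hR : R.LiftsChains) :
    ClassifiedBy X.nervePs (fun n => Fin (n.as.unop.len + 1) ⥤ L)
      (fun θ G => θ.as.unop.toOrderHom.monotone.functor ⋙ G) where
  cls F := R.functor F
  subsingleton_hom F G := R.subsingleton_hom F G
  nonempty_hom_iff F G := R.nonempty_hom_iff F G
  surjective _ := hR _
  cls_map _ _ := rfl

/-- A weakly globular double category can lift chains as soon as it can lift objects and arrows. -/
theorem liftsChains_of_isWeaklyGlobular (hX : X.IsWeaklyGlobular)
    (hobj : Function.Surjective R.obj)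
    (hmap : ∀ {A B : L} (s : A ⟶ B), ∃ f : X.HArr, R.obj f.src = A ∧ R.obj f.tgt = B ∧
      HEq (R.map f.arr) s) : R.LiftsChains := by
  intro n G
  choose F hs ht hF using fun k : Fin n => hmap (G.map (homOfLE k.castSucc_le_succ))
  -- The Segal maps only concern chains of length at least two; shorter chains are lifted by hand.
  rcases lt_or_ge n 2 with hn | hn
  · interval_cases n
    · obtain ⟨a, ha⟩ := hobj (G.obj 0)
      exact R.exists_functor_eq (fun _ => a) (fun k => k.elim0)
        (Fin.cases ha (fun k => k.elim0)) (fun k => k.elim0)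
    · exact R.exists_functor_eq (n := 1) (Fin.cons (F 0).src (fun _ => (F 0).tgt))
        (Fin.cases (F 0).arr (fun i => i.elim0))
        (Fin.cases (hs 0) (Fin.cases (ht 0) (fun k => k.elim0)))
        (Fin.cases (hF 0) (fun k => k.elim0))
  · obtain ⟨D, hD⟩ := hX.exists_chain hn F (fun i j hij => by
      have e : i.succ = j.castSucc := Fin.ext (by simpa using hij)
      rw [R.cc_eq_iff, ht, hs, e])
    have hD' := fun k => (R.nonempty_harrIso_iff _ _).1 (hD k)
    refine ⟨D, finFunctor_ext (fun i => ?_) (fun k => (hD' k).2.2.trans (hF k))⟩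
    induction i using Fin.cases with
    | zero => exact (hD' ⟨0, by omega⟩).1.trans (hs ⟨0, by omega⟩)
    | succ k => exact (hD' k).2.1.trans (ht k)

end Realization

end DblCat

/-! ### Double categories over the localization -/

section Realizations

open MorphismProperty Bicategory

variable {C : Type u} [Category.{v} C] (W : MorphismProperty C)

theorem localization_obj_injective : Function.Injective W.Q.obj :=
  (Localization.Construction.objEquiv W).injective

theorem localization_obj_surjective : Function.Surjective W.Q.obj :=
  (Localization.Construction.objEquiv W).surjective

variable [W.HasRightCalculusOfFractions]

theorem WArrow.sameMap_iff {X X' Y Y' : WArrow W} (f : X.dom ⟶ X'.dom) (g : Y.dom ⟶ Y'.dom)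
    (e : X.cod = Y.cod) (e' : X'.cod = Y'.cod) :
    WArrow.SameMap f g ↔ HEq (spanMap (WArrow.toSpan f)) (spanMap (WArrow.toSpan g)) := by
  have key := conj_eqToHom_iff_heq (spanMap (WArrow.toSpan f)) (spanMap (WArrow.toSpan g))
    (congrArg W.Q.obj e) (congrArg W.Q.obj e')
  rw [← key]
  constructor
  · rintro ⟨_, _, h⟩
    rw [← cancel_mono (eqToHom (congrArg W.Q.obj e')), h]
    simp
  · intro h
    exact ⟨e, e', by rw [h]; simp⟩

/-- The double category `C{W}` over the localization: the object `w : A ⟶ B` lies over `B`, and the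
horizontal arrow `f : w ⟶ w'` over the fraction `w' ∘ f ∘ w⁻¹`. -/
noncomputable def fractionsRealization : (fractionsDbl W).Realization W.Localization where
  obj X := W.Q.obj (WArrow.cod X)
  map f := spanMap (WArrow.toSpan f)
  map_hid X := WArrow.spanMap_toSpan_id X
  map_hcomp f g := WArrow.spanMap_toSpan_comp f g
  subsingleton_ver _ _ := ⟨fun x y => WArrow.Ver.eq x y⟩
  frameThin := inferInstance
  nonempty_ver_iff _ _ := ⟨fun ⟨x⟩ => congrArg W.Q.obj (WArrow.Ver.cod_eq x),
    fun e => WArrow.Ver.nonempty (localization_obj_injective W e)⟩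
  nonempty_cell_iff f g x y := by
    rw [← WArrow.sameMap_iff W f g (WArrow.Ver.cod_eq x) (WArrow.Ver.cod_eq y)]
    exact ⟨fun ⟨α⟩ => WArrow.Cell.sameMap α, fun e => ⟨WArrow.Cell.ofSameMap e x y⟩⟩

theorem fractionsRealization_liftsChains : (fractionsRealization W).LiftsChains := by
  refine DblCat.Realization.liftsChains_of_isWeaklyGlobular _
    (fractionsDbl.isWeaklyGlobular W) (fun A => ?_) (fun {A B} s => ?_)
  · obtain ⟨A, rfl⟩ := localization_obj_surjective W A
    exact ⟨(⟨𝟙 A, W.id_mem _⟩ : WArrow W), rfl⟩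
  · obtain ⟨A, rfl⟩ := localization_obj_surjective W A
    obtain ⟨B, rfl⟩ := localization_obj_surjective W B
    obtain ⟨σ, rfl⟩ := Localization.exists_rightFraction W.Q W s
    refine ⟨⟨(⟨σ.s, σ.hs⟩ : WArrow W), (⟨𝟙 B, W.id_mem _⟩ : WArrow W), σ.f⟩, rfl, rfl, ?_⟩
    refine heq_of_eq ?_
    change spanMap (RightFraction.mk σ.s σ.hs (σ.f ≫ 𝟙 B)) = spanMap σ
    rw [Category.comp_id]

variable {W} {S : ChosenSquares W}

/-- Every arrow of the localization is a fraction. -/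
theorem Frac.exists_toLoc_eq {A B : Frac S} (s : W.Q.obj A.as ⟶ W.Q.obj B.as) :
    ∃ σ : A ⟶ B, Frac.toLoc σ = s :=
  (Localization.exists_rightFraction W.Q W s).imp fun _ e => e.symm

theorem Frac.nonempty_hom_iff {A B : Frac S} (σ τ : A ⟶ B) :
    Nonempty (σ ⟶ τ) ↔ Frac.toLoc σ = Frac.toLoc τ :=
  ⟨fun ⟨φ⟩ => Frac.toLoc_eq φ, fun e => ⟨Frac.mk₂ e⟩⟩

theorem Frac.nonempty_castHom_iff {A B A' B' : Frac S} (e : A = A') (e' : B = B') (σ : A ⟶ B)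
    (τ : A' ⟶ B') :
    Nonempty (castHom e e' σ ⟶ τ) ↔ HEq (Frac.toLoc σ) (Frac.toLoc τ) := by
  subst e e'
  rw [heq_iff_eq]
  exact Frac.nonempty_hom_iff σ τ

variable (Φ : PathComposites (Frac S))

/-- The double category of marked paths of spans over the localization: a marked path lies over its
marked object, and two marks lie over the composite of the fractions between them. -/
noncomputable def markedPathsRealization : (markedPathsDbl Φ).Realization W.Localization where
  obj X := W.Q.obj (MarkedPath.mark X).as
  map f := Frac.toLoc (Φ.φ (MarkedPath.Hor.between f))
  map_hid _ := (congrArg Frac.toLoc (Φ.φ_nil _)).trans (Frac.toLoc_id _)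
  map_hcomp _ _ := (Frac.toLoc_eq (Φ.comparison _ _).hom).trans (Frac.toLoc_comp _ _)
  subsingleton_ver _ _ := ⟨fun ⟨_⟩ ⟨_⟩ => rfl⟩
  frameThin := ⟨fun _ _ _ _ => ⟨fun φ ψ => Frac.two_cell_eq φ ψ⟩⟩
  nonempty_ver_iff _ _ := ⟨fun ⟨⟨x⟩⟩ => congrArg (fun A => W.Q.obj (Frac.as A)) x,
    fun e => ⟨⟨congrArg Frac.mk (localization_obj_injective W e)⟩⟩⟩
  nonempty_cell_iff _ _ x y := Frac.nonempty_castHom_iff x.down y.down _ _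

/-- A chain of arrows of the localization is represented by a chain of spans, and so by a single
path with all its objects marked. -/
theorem markedPathsRealization_liftsChains : (markedPathsRealization Φ).LiftsChains := by
  intro n G
  obtain ⟨b, hb⟩ : ∃ b : Fin (n + 1) → Frac S, ∀ k, W.Q.obj (b k).as = G.obj k := by
    choose b hb using fun k => localization_obj_surjective W (G.obj k)
    exact ⟨fun k => ⟨b k⟩, hb⟩
  choose q hq using fun k : Fin n => Frac.exists_toLoc_eq (S := S) (A := b k.castSucc)
    (B := b k.succ) (eqToHom (hb _) ≫ G.map (homOfLE k.castSucc_le_succ) ≫ eqToHom (hb _).symm)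
  -- The parts of the path `q` of spans before and after its `k`-th object.
  let bef : ∀ k, Quiver.Path (b 0) (b k) :=
    Fin.induction Quiver.Path.nil (fun k p => p.comp (q k).toPath)
  let aft : ∀ k, Quiver.Path (b k) (b (Fin.last n)) :=
    Fin.reverseInduction Quiver.Path.nil (fun k p => (q k).toPath.comp p)
  let p : Fin (n + 1) → MarkedPath (Frac S) := fun k => ⟨bef k, aft k⟩
  let m : ∀ k : Fin n, MarkedPath.Hor (p k.castSucc) (p k.succ) := fun k =>
    { fst_eq := rfl
      lst_eq := rfl
      between := (q k).toPath
      before_eq := rfl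
      after_eq := (Fin.reverseInduction_castSucc
        (motive := fun k => Quiver.Path (b k) (b (Fin.last n))) k).symm }
  have hm : ∀ k, Frac.toLoc (Φ.φ (m k).between) = Frac.toLoc (q k) := by
    intro k
    obtain ⟨i⟩ := (Φ.isComposite (q k).toPath).nonempty_iso
    obtain ⟨j⟩ := (IsComposite.single (q k)).nonempty_iso
    exact (Frac.toLoc_eq i.hom).trans (Frac.toLoc_eq j.inv)
  exact (markedPathsRealization Φ).exists_functor_eq p m hb fun k =>
    (heq_of_eq ((hm k).trans (hq k))).trans
      ((eqToHom_comp_heq _ _).trans (comp_eqToHom_heq _ _))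

end Realizations

/-! ### Normal homomorphisms and icons between locally posetal bicategories -/

section LocallyPosetal

open Bicategory

universe w₁ w₂ v₁ v₂ u₁ u₂

variable {B : Type u₁} [Bicategory.{w₁, v₁} B] {D : Type u₂} [Bicategory.{w₂, v₂} D]

/-- A normal homomorphism into a locally posetal bicategory is a map of objects and arrows which
preserves units strictly, composites up to isomorphism, and the existence of 2-cells. -/
theorem exists_strictlyUnitaryPseudofunctor
    (hD : ∀ {a b : D} {f g : a ⟶ b} (φ ψ : f ⟶ g), φ = ψ) (F : Prefunctor B D)
    (map_id : ∀ a : B, F.map (𝟙 a) = 𝟙 (F.obj a))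
    (map₂ : ∀ {a b : B} {f g : a ⟶ b}, (f ⟶ g) → Nonempty (F.map f ⟶ F.map g))
    (mapComp : ∀ {a b c : B} (f : a ⟶ b) (g : b ⟶ c),
      Nonempty (F.map (f ≫ g) ≅ F.map f ≫ F.map g)) :
    ∃ K : StrictlyUnitaryPseudofunctor B D, K.toPrefunctor = F :=
  ⟨StrictlyUnitaryPseudofunctor.mk'
    { obj := F.obj
      map := F.map
      map_id := map_id
      map₂ := fun φ => (map₂ φ).some
      map₂_id := fun _ => hD _ _
      map₂_comp := fun _ _ => hD _ _
      mapComp := fun f g => (mapComp f g).some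
      map₂_whisker_left := fun _ _ _ _ => hD _ _
      map₂_whisker_right := fun _ _ => hD _ _
      map₂_left_unitor := fun _ => hD _ _
      map₂_right_unitor := fun _ => hD _ _
      map₂_associator := fun _ _ _ => hD _ _ }, rfl⟩

theorem StrictlyUnitaryPseudofunctor.ext_toPrefunctor
    (hD : ∀ {a b : D} {f g : a ⟶ b} (φ ψ : f ⟶ g), φ = ψ)
    {F G : StrictlyUnitaryPseudofunctor B D} (e : F.toPrefunctor = G.toPrefunctor) : F = G := by
  obtain ⟨⟨⟨⟨F, F₂⟩, _, _⟩, Fi, Fc, _, _, _, _, _⟩, _, _⟩ := F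
  obtain ⟨⟨⟨⟨G, G₂⟩, _, _⟩, Gi, Gc, _, _, _, _, _⟩, _, _⟩ := G
  dsimp only at e
  subst e
  obtain rfl : @F₂ = @G₂ := by
    funext _ _ _ _ _
    exact hD _ _
  obtain rfl : Fi = Gi := funext fun _ => Iso.ext (hD _ _)
  obtain rfl : @Fc = @Gc := by
    funext _ _ _ _ _
    exact Iso.ext (hD _ _)
  rfl

/-- An icon into a locally posetal bicategory is given by the existence of its components, which
depends only on the underlying maps of objects and arrows. -/
theorem exists_icon (hD : ∀ {a b : D} {f g : a ⟶ b} (φ ψ : f ⟶ g), φ = ψ)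
    (hinv : ∀ {a b : D} {f g : a ⟶ b}, (f ⟶ g) → Nonempty (g ⟶ f))
    {F G : StrictlyUnitaryPseudofunctor B D} {F' G' : Prefunctor B D}
    (hF : F.toPrefunctor = F') (hG : G.toPrefunctor = G') (e : ∀ a, F'.obj a = G'.obj a)
    (app : ∀ {a b : B} (f : a ⟶ b), Nonempty (castHom (e a) (e b) (F'.map f) ⟶ G'.map f)) :
    ∃ η : Icon F G, η.IsInvertible := by
  subst hF hG
  exact ⟨{ obj_eq := e
           app := fun f => (app f).some
           naturality := fun _ => hD _ _
           app_id := fun _ => hD _ _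
           app_comp := fun _ _ => hD _ _ },
    fun f => ⟨(hinv (app f).some).some, hD _ _, hD _ _⟩⟩

end LocallyPosetal

/-! ### The comparison of the two bicategories -/

section Comparison

open MorphismProperty Bicategory fractionsDbl

variable {C : Type u} [Category.{v} C] {W : MorphismProperty C} [W.HasRightCalculusOfFractions]

theorem spanMap_comp_eqToHom_heq {X X' : WArrow W} (f : X.dom ⟶ X'.dom) {A A' : C} (e : X.cod = A)
    (e' : X'.cod = A') :
    HEq (spanMap (RightFraction.mk (X.hom ≫ eqToHom e) (comp_eqToHom_mem X.hom X.mem e)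
      (f ≫ X'.hom ≫ eqToHom e'))) (spanMap (WArrow.toSpan f)) := by
  subst e e'
  simp only [eqToHom_refl, Category.comp_id]
  rfl

variable (M : (fractionsDbl W).SegalChoice) (S : ChosenSquares W)

/-- The fraction represented by a horizontal arrow of `C{W}` is the one represented by the
corresponding span. -/
theorem toLoc_omegaMap {a b : BicFractions W M} (f : a ⟶ b) :
    HEq (Frac.toLoc ((omegaMap M S).map f))
      ((fractionsRealization W).map (DblCat.Bic.Hom.arr f).arr) :=
  spanMap_comp_eqToHom_heq (X := f.arr.src) (X' := f.arr.tgt) f.arr.arr _ _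

theorem obj_src_eq {a b : BicFractions W M} (f : a ⟶ b) :
    (fractionsRealization W).obj (DblCat.Bic.Hom.arr f).src = W.Q.obj (compCod a.comp) :=
  congrArg (fun x => W.Q.obj (compCod x)) (DblCat.Bic.Hom.src_eq f)

theorem obj_tgt_eq {a b : BicFractions W M} (f : a ⟶ b) :
    (fractionsRealization W).obj (DblCat.Bic.Hom.arr f).tgt = W.Q.obj (compCod b.comp) :=
  congrArg (fun x => W.Q.obj (compCod x)) (DblCat.Bic.Hom.tgt_eq f)

/-- The 2-cells of `Bic(C{W})` are the equalities of fractions. -/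
theorem nonempty_bicHom_iff {a b : BicFractions W M} (f g : a ⟶ b) :
    Nonempty (f ⟶ g) ↔
      Frac.toLoc ((omegaMap M S).map f) = Frac.toLoc ((omegaMap M S).map g) := by
  rw [← heq_iff_eq]
  refine ((fractionsRealization W).nonempty_harrHom_iff (DblCat.Bic.Hom.arr f)
    (DblCat.Bic.Hom.arr g)).trans ⟨fun e => ?_, fun e => ?_⟩
  · exact (toLoc_omegaMap M S f).trans (e.2.2.trans (toLoc_omegaMap M S g).symm)
  · exact ⟨(obj_src_eq M f).trans (obj_src_eq M g).symm,
      (obj_tgt_eq M f).trans (obj_tgt_eq M g).symm,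
      (toLoc_omegaMap M S f).symm.trans (e.trans (toLoc_omegaMap M S g))⟩

theorem comp_heq_comp {D : Type u} [Category.{w} D] {a b c a' b' c' : D} (e : a = a')
    (e' : b = b') (e'' : c = c') {f : a ⟶ b} {g : b ⟶ c} {f' : a' ⟶ b'} {g' : b' ⟶ c'}
    (hf : HEq f f') (hg : HEq g g') : HEq (f ≫ g) (f' ≫ g') := by
  subst e e' e''
  rw [eq_of_heq hf, eq_of_heq hg]

/-- The composite of two arrows of `Bic(C{W})` represents the composite fraction, for every choice of
composable replacements: these are isomorphic to the given arrows, and so represent the same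
fractions. -/
theorem toLoc_omegaMap_comp {a b c : BicFractions W M} (f : a ⟶ b) (g : b ⟶ c) :
    Frac.toLoc ((omegaMap M S).map (f ≫ g)) =
      Frac.toLoc ((omegaMap M S).map f) ≫ Frac.toLoc ((omegaMap M S).map g) := by
  let R := fractionsRealization W
  let m := DblCat.Bic.replace f g
  obtain ⟨e₁, e₂, e₃⟩ := (R.nonempty_harrIso_iff _ _).1 ⟨m.isoFst⟩
  obtain ⟨-, e₄, e₅⟩ := (R.nonempty_harrIso_iff _ _).1 ⟨m.isoSnd⟩
  refine eq_of_heq ((toLoc_omegaMap M S (f ≫ g)).trans ?_)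
  refine (heq_of_eq (R.map_hcomp m.fst m.snd)).trans ?_
  exact comp_heq_comp (e₁.trans (obj_src_eq M f)) (e₂.trans (obj_tgt_eq M f))
    (e₄.trans (obj_tgt_eq M g)) (e₃.trans (toLoc_omegaMap M S f).symm)
    (e₅.trans (toLoc_omegaMap M S g).symm)

theorem omegaMap_map_id (a : BicFractions W M) :
    (omegaMap M S).map (𝟙 a) = 𝟙 ((omegaMap M S).obj a) := by
  -- The representative of `a` has the codomain of `a` on the nose, so the transports are identities.
  change RightFraction.mk (𝟙 (compCod a.comp) ≫ 𝟙 _) _ (𝟙 (compCod a.comp) ≫ 𝟙 _ ≫ 𝟙 _) =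
    RightFraction.mk (𝟙 (compCod a.comp)) _ (𝟙 (compCod a.comp))
  simp only [Category.comp_id]

/-- The identity `ωα = Id` on arrows. -/
theorem omegaMap_alphaMap {A B : Frac S} (σ : A ⟶ B) :
    (omegaMap M S).map ((alphaMap M S).map σ) = σ := by
  change RightFraction.mk (RightFraction.s σ ≫ 𝟙 _) _ (RightFraction.f σ ≫ 𝟙 _ ≫ 𝟙 _) = σ
  simp only [Category.comp_id]
  rfl

theorem nonempty_castHom_bicHom {a b a' b' : BicFractions W M} (e : a = a') (e' : b = b')
    (f : a ⟶ b) (g : a' ⟶ b')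
    (h : HEq (Frac.toLoc ((omegaMap M S).map f)) (Frac.toLoc ((omegaMap M S).map g))) :
    Nonempty (castHom e e' f ⟶ g) := by
  subst e e'
  exact (nonempty_bicHom_iff M S f g).2 (eq_of_heq h)

theorem alphaMap_omegaMap_obj (a : BicFractions W M) :
    (alphaMap M S).obj ((omegaMap M S).obj a) = a :=
  congrArg DblCat.Bic.mk ((idRep W).cc_rep a.comp)

theorem bicFractions_two_cell_eq {a b : BicFractions W M} {f g : a ⟶ b} (φ ψ : f ⟶ g) : φ = ψ :=
  DblCat.Bic.two_cell_eq φ ψ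

theorem exists_omega : ∃ ω : StrictlyUnitaryPseudofunctor (BicFractions W M) (Frac S),
    ω.toPrefunctor = omegaMap M S :=
  exists_strictlyUnitaryPseudofunctor Frac.two_cell_eq _ (omegaMap_map_id M S)
    (fun φ => ⟨Frac.mk₂ ((nonempty_bicHom_iff M S _ _).1 ⟨φ⟩)⟩)
    (fun f g => ⟨Frac.mkIso ((toLoc_omegaMap_comp M S f g).trans (Frac.toLoc_comp _ _).symm)⟩)

theorem exists_alpha : ∃ α : StrictlyUnitaryPseudofunctor (Frac S) (BicFractions W M),
    α.toPrefunctor = alphaMap M S := by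
  have key : ∀ {A B : Frac S} {f g : (alphaMap M S).obj A ⟶ (alphaMap M S).obj B},
      Frac.toLoc ((omegaMap M S).map f) = Frac.toLoc ((omegaMap M S).map g) → Nonempty (f ≅ g) :=
    fun e => ⟨⟨((nonempty_bicHom_iff M S _ _).2 e).some,
      ((nonempty_bicHom_iff M S _ _).2 e.symm).some, bicFractions_two_cell_eq M _ _,
      bicFractions_two_cell_eq M _ _⟩⟩
  refine exists_strictlyUnitaryPseudofunctor (bicFractions_two_cell_eq M) _ (fun _ => rfl)
    (fun {A B σ τ} φ => ?_) (fun {A B D} σ τ => key ?_)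
  · obtain ⟨i⟩ := key (f := (alphaMap M S).map σ) (g := (alphaMap M S).map τ) (by
      rw [omegaMap_alphaMap, omegaMap_alphaMap]
      exact Frac.toLoc_eq φ)
    exact ⟨i.hom⟩
  · rw [omegaMap_alphaMap, toLoc_omegaMap_comp, omegaMap_alphaMap, omegaMap_alphaMap]
    exact Frac.toLoc_comp σ τ

end Comparison

theorem mainTheorem5 {C : Type u} [Category.{v} C] (W : MorphismProperty C)
    [W.HasRightCalculusOfFractions] (hW : MorphismProperty.isomorphisms C ≤ W)
    (S : ChosenSquares W) (M : (fractionsDbl W).SegalChoice) (Φ : PathComposites (Frac S)) :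
    IconEquivalent (BicFractions W M) (Frac S) ∧
    (∃ (ω : StrictlyUnitaryPseudofunctor (BicFractions W M) (Frac S))
        (α : StrictlyUnitaryPseudofunctor (Frac S) (BicFractions W M)),
      ω.toPrefunctor = omegaMap M S ∧ α.toPrefunctor = alphaMap M S ∧
      α.comp ω = StrictlyUnitaryPseudofunctor.id (Frac S) ∧
      ∃ ζ : Icon (ω.comp α) (StrictlyUnitaryPseudofunctor.id (BicFractions W M)),
        ζ.IsInvertible) ∧
    (∀ (A B : Frac S) (σ τ : A ⟶ B) (φ ψ : σ ⟶ τ), φ = ψ) ∧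
    (fractionsDbl W).IsWeaklyGlobular ∧ (markedPathsDbl Φ).IsWeaklyGlobular ∧
    PsEquivalent (fractionsDbl W).nervePs (markedPathsDbl Φ).nervePs := by
  obtain ⟨ω, hω⟩ := exists_omega M S
  obtain ⟨α, hα⟩ := exists_alpha M S
  have h₁ : α.comp ω = StrictlyUnitaryPseudofunctor.id (Frac S) := by
    apply StrictlyUnitaryPseudofunctor.ext_toPrefunctor Frac.two_cell_eq
    change α.toPrefunctor ⋙q ω.toPrefunctor = 𝟭q (Frac S)
    rw [hω, hα]
    exact Prefunctor.ext (fun _ => rfl) (fun _ _ σ => omegaMap_alphaMap M S σ)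
  have h₂ : ∃ ζ : Icon (ω.comp α) (StrictlyUnitaryPseudofunctor.id (BicFractions W M)),
      ζ.IsInvertible := by
    refine exists_icon (bicFractions_two_cell_eq M) (fun φ => ?_)
      (F' := omegaMap M S ⋙q alphaMap M S) (G' := 𝟭q (BicFractions W M)) ?_ rfl
      (alphaMap_omegaMap_obj M S) (fun {a b} f => ?_)
    · exact (nonempty_bicHom_iff M S _ _).2 ((nonempty_bicHom_iff M S _ _).1 ⟨φ⟩).symm
    · change ω.toPrefunctor ⋙q α.toPrefunctor = _
      rw [hω, hα]
    · exact nonempty_castHom_bicHom M S _ _ _ _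
        (heq_of_eq (congrArg Frac.toLoc (omegaMap_alphaMap M S ((omegaMap M S).map f))))
  have h₃ : ∃ θ : Icon (α.comp ω) (StrictlyUnitaryPseudofunctor.id (Frac S)),
      θ.IsInvertible := by
    rw [h₁]
    exact exists_icon Frac.two_cell_eq (fun φ => ⟨Frac.mk₂ (Frac.toLoc_eq φ).symm⟩)
      rfl rfl (fun _ => rfl) (fun _ => ⟨𝟙 _⟩)
  have hF := fractionsRealization_liftsChains W
  have hΦ := markedPathsRealization_liftsChains Φ
  exact ⟨⟨ω, α, h₂, h₃⟩, ⟨ω, α, hω, hα, h₁, h₂⟩, fun _ _ _ _ φ ψ => Frac.two_cell_eq φ ψ,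
    fractionsDbl.isWeaklyGlobular W, hΦ.isWeaklyGlobular,
    hF.classifiedBy.nonempty_equivalence hΦ.classifiedBy⟩
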